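/- **Setting.** Let $d\ge 1$ and $p\ge 0$ be integers. A mesh $\mathcal T_h$ is a finite family of convex polytopes $K\subset\mathbb R^d$ with non-empty, pairwise disjoint interiors (it meshes the interior of their union); hanging nodes are allowed. It is shape-regular with constant $\kappa$ if every $K\in\mathcal T_h$ contains a ball of some radius $\rho_K>0$ with $\operatorname{diam}K\le\kappa\rho_K$. Let $\Gamma_i$ be the set of interior intersections, that is, of the sets $e=K_e^-\cap K_e^+$ of positive $(d-1)$-dimensional surface measure $|e|$ with $K_e^-\ne K_e^+$ in $\mathcal T_h$, let $\mathbf n$ be the unit normal on $e$ pointing from $K_e^-$ to $K_e^+$, let $m_K$ be the number of $e\in\Gamma_i$ on $\partial K$, and put $$h_e=\frac{2|K_e^+||K_e^-|}{|e|\,(|K_e^-|+|K_e^+|)}.$$ Let $V_h^p$ be the space of functions whose restriction to each $K\in\mathcal T_h$ is a polynomial of total degree at most $p$, and write $(f,g)=\sum_{K}\int_K fg\,dx$. On $e\in\Gamma_i$ write $[\![v]\!]=v^--v^+$, $\{\!\{v\}\!\}=\tfrac12(v^-+v^+)$, and for a piecewise constant $w\ge0$ let $\langle w\rangle=\frac{2w^+w^-}{w^++w^-}$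 be the harmonic average, equal to $0$ if $w^+=w^-=0$. Let $\Pi^0 v$ be the piecewise constant function of the cell averages $|K|^{-1}\int_K v\,dx$, and let $M(s)=\max\{1-s^2,0\}$ be the degenerate mobility. For penalty parameters $\eta=(\eta_e)_{e\in\Gamma_i}$, a piecewise constant $w\ge 0$ and $u,v\in V_h^p$ put $$b(w,u,v)=\sum_{K}\int_K w\,\nabla u\cdot\nabla v\,dx+\sum_{e\in\Gamma_i}\int_e\langle w\rangle\Big(\frac{\eta_e}{h_e}[\![u]\!][\![v]\!]-\{\!\{\nabla u\cdot\mathbf n\}\!\}[\![v]\!]-\{\!\{\nabla v\cdot\mathbf n\}\!\}[\![u]\!]\Big)ds,$$ and $a(u,v)=b(1,u,v)$. **Theorem (Existence of solutions to SWIPDP).** For all $d\ge1$, $p\ge0$ and $\kappa$ there is a constant $C_T\ge 0$, depending only on $d$, $p$ and $\kappa$, with $C_T=0$ if $p=0$, such that the following holds. Let $\mathcal T_h$ be a mesh that is shape-regular with constant $\kappa$, and let the penalty parameters be sufficiently large in the sense that $\eta_e>0$ and $\eta_e\ge C_T\,m_K$ for $K\in\{K_e^-,K_e^+\}$ and all $e\in\Gamma_i$.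 Then for all $\tau>0$, $\mathrm{Pe}>0$, $\mathrm{Cn}>0$ and every initial phase field $\phi_h^0\in V_h^p$ there exists a solution $(\phi_h^1,\upsilon_h^1)\in V_h^p\times V_h^p$ of the SWIPDP scheme with degenerate mobility, that is, $$\frac1\tau(\phi_h^1-\phi_h^0,\varphi)+\mathrm{Pe}^{-1}\,b\big(M(\Pi^0\phi_h^1),\upsilon_h^1,\varphi\big)=0\qquad\text{for all }\varphi\in V_h^p,$$ $$(\upsilon_h^1,\xi)-\big((\phi_h^1)^3-\phi_h^0,\xi\big)-\mathrm{Cn}^2\,a(\phi_h^1,\xi)=0\qquad\text{for all }\xi\in V_h^p.$$ -/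

import Mathlib

open MeasureTheory
open scoped Real

namespace SWIPDP

noncomputable section

/-- The ambient space `ℝ^d` with its Euclidean norm. -/
abbrev Space (d : ℕ) : Type := EuclideanSpace ℝ (Fin d)

/-- A mesh of a polytopal domain of `ℝ^d`: finitely many convex polytopes with non-empty interior,
whose interiors are pairwise disjoint. The meshed domain is the interior of their union.
Hanging nodes are allowed. -/
structure Mesh (d : ℕ) where
  /-- the number of elements -/
  size : ℕ
  /-- the (closed) elements -/
  elem : Fin size → Set (Space d)
  isPolytope : ∀ i, ∃ s : Finset (Space d), elem i = convexHull ℝ (s : Set (Space d))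
  interior_nonempty : ∀ i, (interior (elem i)).Nonempty
  disjoint_interior : ∀ i j, i ≠ j → Disjoint (interior (elem i)) (interior (elem j))

namespace Mesh

variable {d : ℕ} (T : Mesh d)

/-- Shape regularity with constant `κ`: the diameter of each element is at most `κ` times the
radius of some ball that it contains. -/
def ShapeRegular (κ : ℝ) : Prop :=
  ∀ i, ∃ (x : Space d) (ρ : ℝ), 0 < ρ ∧ Metric.closedBall x ρ ⊆ T.elem i ∧
    Metric.diam (T.elem i) ≤ κ * ρ

/-- The volume `|K|` of an element. -/
def vol (i : Fin T.size) : ℝ := (volume (T.elem i)).toReal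

/-- A pair `e = (i, j)` of elements; for `i < j` it stands for the intersection of the elements
`K⁻ = K_i` and `K⁺ = K_j`. -/
abbrev Pair : Type := Fin T.size × Fin T.size

/-- The intersection `e = K⁻ ∩ K⁺` as a set of points. -/
def face (e : T.Pair) : Set (Space d) := T.elem e.1 ∩ T.elem e.2

/-- The surface measure: the `(d-1)`-dimensional Hausdorff measure, normalised so that it agrees
with the `(d-1)`-dimensional Lebesgue measure on hyperplanes (the counting measure if `d = 1`). -/
def surf (d : ℕ) : Measure (Space d) := Measure.euclideanHausdorffMeasure (d - 1)

/-- The area `|e|` of an intersection. -/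
def area (e : T.Pair) : ℝ := (surf d (T.face e)).toReal

open scoped Classical in
/-- The set `Γ_i` of the interior intersections: the sets `K⁻ ∩ K⁺` of positive surface measure,
for two different elements, each listed once. -/
def innerFaces : Finset T.Pair :=
  Finset.univ.filter fun e => e.1 < e.2 ∧ surf d (T.face e) ≠ 0

open scoped Classical in
/-- The number `m_K` of interior intersections on the boundary of the element `K`. -/
def numFaces (i : Fin T.size) : ℕ :=
  (T.innerFaces.filter fun e => e.1 = i ∨ e.2 = i).card

/-- `h_e`, the harmonic mean of the volumes of the two elements, divided by `|e|`. -/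
def width (e : T.Pair) : ℝ :=
  2 * T.vol e.2 * T.vol e.1 / (T.area e * (T.vol e.1 + T.vol e.2))

/-- `ν` is a unit vector that points from `A` to `B`, across a hyperplane separating them. -/
def IsUnitNormal (A B : Set (Space d)) (ν : Space d) : Prop :=
  ‖ν‖ = 1 ∧ ∀ x ∈ A, ∀ y ∈ B, inner ℝ ν x ≤ inner ℝ ν y

theorem convex_elem (i : Fin T.size) : Convex ℝ (T.elem i) := by
  obtain ⟨s, hs⟩ := T.isPolytope i
  rw [hs]
  exact convex_convexHull ℝ _

theorem exists_isUnitNormal (i j : Fin T.size) (hij : i ≠ j) :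
    ∃ ν : Space d, IsUnitNormal (T.elem i) (T.elem j) ν := by
  have hsub : ∀ k, T.elem k ⊆ closure (interior (T.elem k)) := fun k => by
    rw [(T.convex_elem k).closure_interior_eq_closure_of_nonempty_interior
      (T.interior_nonempty k)]
    exact subset_closure
  obtain ⟨f, u, hf, hg⟩ := geometric_hahn_banach_open_open (T.convex_elem i).interior
    isOpen_interior (T.convex_elem j).interior isOpen_interior (T.disjoint_interior i j hij)
  have hf' : ∀ x ∈ T.elem i, f x ≤ u := fun x hx =>
    closure_minimal (fun y hy => (hf y hy).le) (isClosed_le f.continuous continuous_const)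
      (hsub i hx)
  have hg' : ∀ x ∈ T.elem j, u ≤ f x := fun x hx =>
    closure_minimal (fun y hy => (hg y hy).le) (isClosed_le continuous_const f.continuous)
      (hsub j hx)
  set v := (InnerProductSpace.toDual ℝ (Space d)).symm f with hv
  have hfv : ∀ x, inner ℝ v x = f x := fun x => by
    rw [hv, InnerProductSpace.toDual_symm_apply]
  have hv0 : v ≠ 0 := by
    intro h0
    obtain ⟨a, ha⟩ := T.interior_nonempty i
    obtain ⟨b, hb⟩ := T.interior_nonempty j
    have h1 := hf a ha
    have h2 := hg b hb
    rw [← hfv, h0, inner_zero_left] at h1 h2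
    exact lt_asymm h1 h2
  refine ⟨‖v‖⁻¹ • v, ?_, fun x hx y hy => ?_⟩
  · rw [norm_smul, norm_inv, norm_norm, inv_mul_cancel₀ (norm_ne_zero_iff.mpr hv0)]
  · rw [real_inner_smul_left, real_inner_smul_left, hfv, hfv]
    exact mul_le_mul_of_nonneg_left ((hf' x hx).trans (hg' y hy))
      (inv_nonneg.mpr (norm_nonneg v))

open scoped Classical in
/-- The unit normal `n` on the intersection `e`, pointing from `K⁻` to `K⁺`. It is the only such
vector if `e` is an interior intersection. -/
def normal (e : T.Pair) : Space d :=
  if h : e.1 ≠ e.2 then (T.exists_isUnitNormal e.1 e.2 h).choose else 0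

end Mesh

variable {d : ℕ}

/-- The broken polynomial space `V_h^p`: a polynomial of total degree at most `p` on each element.
Since elements have non-empty interior, it is the same to give the polynomials or the functions;
the one-sided traces on an intersection are the values of the two polynomials. -/
abbrev BrokenPoly (T : Mesh d) (p : ℕ) : Type :=
  Fin T.size → MvPolynomial.restrictTotalDegree (Fin d) ℝ p

section Forms

variable {T : Mesh d} {p : ℕ}

/-- The value at `x` of (the polynomial that is) `u` on the element `i`. -/
def val (u : BrokenPoly T p) (i : Fin T.size) (x : Space d) : ℝ :=
  MvPolynomial.eval (fun k => x k) (u i : MvPolynomial (Fin d) ℝ)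

/-- The gradient at `x` of `u` on the element `i`. -/
def grad (u : BrokenPoly T p) (i : Fin T.size) (x : Space d) : Space d :=
  WithLp.toLp 2 fun k =>
    MvPolynomial.eval (fun l => x l) (MvPolynomial.pderiv k (u i : MvPolynomial (Fin d) ℝ))

/-- The inner product `∑_K ∫_K f g` of two functions that are given element by element. -/
def innerProd (f g : Fin T.size → Space d → ℝ) : ℝ :=
  ∑ i, ∫ x in T.elem i, f i x * g i x

/-- The cell average `|K|⁻¹ ∫_K u`. -/
def cellAvg (u : BrokenPoly T p) (i : Fin T.size) : ℝ :=
  (T.vol i)⁻¹ * ∫ x in T.elem i, val u i x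

/-- The jump `u⁻ - u⁺` across `e`. -/
def jump (u : BrokenPoly T p) (e : T.Pair) (x : Space d) : ℝ := val u e.1 x - val u e.2 x

/-- The arithmetic average across `e` of the normal derivative `∇u · n`. -/
def avgNormalDeriv (u : BrokenPoly T p) (e : T.Pair) (x : Space d) : ℝ :=
  (inner ℝ (grad u e.1 x) (T.normal e) + inner ℝ (grad u e.2 x) (T.normal e)) / 2

/-- The degenerate mobility `M(s) = max {1 - s², 0}`. -/
def mobility (s : ℝ) : ℝ := max (1 - s ^ 2) 0

/-- The harmonic average `2 w⁺ w⁻ / (w⁺ + w⁻)` across `e` of a piecewise constant function `w`;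
it is `0` if `w⁺ = w⁻ = 0`. -/
def harmonicAvg (w : Fin T.size → ℝ) (e : T.Pair) : ℝ :=
  2 * w e.2 * w e.1 / (w e.2 + w e.1)

/-- The form `b(w, u, v)` for a piecewise constant diffusion coefficient `w`, with the penalty
parameters `η`. Boundary intersections contribute nothing, as no jump occurs there. -/
def formB (η : T.Pair → ℝ) (w : Fin T.size → ℝ) (u v : BrokenPoly T p) : ℝ :=
  (∑ i, ∫ x in T.elem i, w i * inner ℝ (grad u i x) (grad v i x)) +
  ∑ e ∈ T.innerFaces, ∫ x in T.face e, harmonicAvg w e *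
    (η e / T.width e * jump u e x * jump v e x - avgNormalDeriv u e x * jump v e x
      - avgNormalDeriv v e x * jump u e x) ∂(Mesh.surf d)

/-- The form `a(u, v)` that discretises the Laplacian, with the penalty parameters `η`. -/
def formA (η : T.Pair → ℝ) (u v : BrokenPoly T p) : ℝ :=
  (∑ i, ∫ x in T.elem i, inner ℝ (grad u i x) (grad v i x)) +
  ∑ e ∈ T.innerFaces, ∫ x in T.face e,
    (η e / T.width e * jump u e x * jump v e x - avgNormalDeriv u e x * jump v e x
      - avgNormalDeriv v e x * jump u e x) ∂(Mesh.surf d)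

/-- The convex part `Φ⁺` of the Eyre splitting of the quartic double-well potential. -/
def phiPlus (s : ℝ) : ℝ := s ^ 3

/-- The concave part `Φ⁻` of the Eyre splitting of the quartic double-well potential. -/
def phiMinus (s : ℝ) : ℝ := -s

/-- `(φ₁, υ₁)` solves one time step, of length `τ`, of the scheme with previous phase field `φ₀`,
Péclet number `Pe`, Cahn number `Cn` and penalty parameters `η`. -/
structure IsSolution (η : T.Pair → ℝ) (τ Pe Cn : ℝ) (φ₀ φ₁ υ₁ : BrokenPoly T p) : Prop where
  eq_phase : ∀ ψ : BrokenPoly T p,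
    1 / τ * innerProd (val (φ₁ - φ₀)) (val ψ)
      + Pe⁻¹ * formB η (fun i => mobility (cellAvg φ₁ i)) υ₁ ψ = 0
  eq_potential : ∀ ξ : BrokenPoly T p,
    innerProd (val υ₁) (val ξ)
      - innerProd (fun i x => phiPlus (val φ₁ i x) + phiMinus (val φ₀ i x)) (val ξ)
      - Cn ^ 2 * formA η φ₁ ξ = 0

end Forms

end

end SWIPDP

/-! In coordinates orthonormal in `L²`, put `φ₁ = φ₀ + x`. The potential equation gives `υ = G(φ₀ +
x)` explicitly, and what remains is `x + B(φ₀ + x) υ = 0`, where `B` represents `(τ/Pe) b`. Testing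
the first equation with `x` and the second with `υ` cancels the cross terms and leaves `g(φ₀ + x)(x)
+ (τ/Pe) b(υ, υ)`. The first summand is coercive in `x`: the cubic dominates a square, `a(x, x) ≥
0`, and `a(φ₀, x)` is linear in `x`. The second is only nonnegative, since the mobility may vanish,
so nothing controls `υ`. Adding `ε υ` yields a vector field pointing outwards on a large sphere,
which has a zero by Brouwer's theorem (`exists_zero_of_inner_pos`). The bound on `x` does not depend
on `ε`, and `υ` is a continuous function of `x`, so a limit point as `ε → 0` solves the system
(`exists_solution_of_coercive`).

Brouwer's theorem comes from the Jacobian integral: a nowhere vanishing field would give a `C¹` map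
of the ball into its sphere fixing the sphere. Its Jacobian is zero, yet
`integral_det_one_add_fderiv` makes the integral equal to the volume of the ball.

Semidefiniteness of `b(w, ·, ·)` for every `w ≥ 0` (`formB_self_nonneg`) rests on an inverse
inequality: `|∇u|² |K|` on `K` is at most `C ∫_K |∇u|²`, by scaling to the unit ball. With `1/h_e =
|e|/(2|K⁻|) + |e|/(2|K⁺|)`, the penalty splits into halves, each absorbing the normal derivative of
one side at the price of a fraction `1/m_K` of the element's energy. The harmonic average is at most
twice either weight, so the prices still add up to no more than the weighted energy. -/

/-! ### Brouwer's theorem and solvability of the abstract system -/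

section ZeroLemma

open Set Filter Topology

variable {E : Type*} [NormedAddCommGroup E] [InnerProductSpace ℝ E] [FiniteDimensional ℝ E]

/-- Along a line through the identity, `det` is interpolated by its values at any `n + 1` points,
with weights that add up to `1`. -/
theorem exists_interpolation_det (E : Type*) [NormedAddCommGroup E] [InnerProductSpace ℝ E]
    [FiniteDimensional ℝ E] {t₀ : ℝ} (ht₀ : 0 < t₀) :
    ∃ (s : Finset ℝ) (c : ℝ → ℝ), (∀ t ∈ s, 0 ≤ t ∧ t < t₀) ∧ ∑ t ∈ s, c t = 1 ∧
      ∀ A : E →L[ℝ] E, (1 + A).det = ∑ t ∈ s, c t * (1 + t • A).det := by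
  classical
  -- As a function of `t`, `det (1 + t A)` is a polynomial of degree at most `dim E`. Hence `dim E +
  -- 1` nodes near `0` determine its value at `1`, with weights independent of `A`.
  obtain ⟨s, hs, hcard⟩ := (Set.Ico_infinite ht₀).exists_subset_card_eq
    (Module.finrank ℝ E + 1)
  have hinj : Set.InjOn (id : ℝ → ℝ) s := Function.injective_id.injOn
  have hne : s.Nonempty := Finset.card_pos.mp (by omega)
  refine ⟨s, fun t => (Lagrange.basis s id t).eval 1, fun t ht => hs ht, ?_, fun A => ?_⟩
  · rw [← Polynomial.eval_finsetSum, Lagrange.sum_basis hinj hne, Polynomial.eval_one]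
  · set b := Module.finBasis ℝ E
    set M := LinearMap.toMatrix b b (A : E →ₗ[ℝ] E)
    set P : Polynomial ℝ := Matrix.det
      ((Polynomial.X : Polynomial ℝ) • M.map Polynomial.C + (1 : Matrix _ _ ℝ).map Polynomial.C)
    have hP : ∀ t : ℝ, (1 + t • A).det = P.eval t := fun t => by
      have h1 : (1 + t • A).det = (1 + t • M).det := by
        rw [ContinuousLinearMap.det, ← LinearMap.det_toMatrix b]
        congr 1
        rw [ContinuousLinearMap.toLinearMap_add, map_add, ContinuousLinearMap.toLinearMap_smul,
          map_smul]
        congr 1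
        exact LinearMap.toMatrix_one b
      rw [h1, ← Polynomial.coe_evalRingHom, RingHom.map_det]
      congr 1
      ext i j
      simp only [Matrix.add_apply, Matrix.smul_apply, Matrix.one_apply, RingHom.mapMatrix_apply,
        Matrix.map_apply, smul_eq_mul, Polynomial.coe_evalRingHom, Polynomial.eval_add,
        Polynomial.eval_mul, Polynomial.eval_X, Polynomial.eval_C]
      ring
    have hdeg : P.degree < s.card := by
      refine (Polynomial.degree_le_natDegree).trans_lt ?_
      have := Polynomial.natDegree_det_X_add_C_le M 1
      rw [Fintype.card_fin] at this
      rw [hcard]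
      exact_mod_cast Nat.lt_succ_of_le this
    have h1 := hP 1
    rw [one_smul] at h1
    rw [h1, Lagrange.eq_interpolate hinj hdeg, Lagrange.interpolate_apply,
      Polynomial.eval_finsetSum]
    refine Finset.sum_congr rfl fun t _ => ?_
    rw [hP, Polynomial.eval_mul, Polynomial.eval_C, mul_comm]
    rfl

/-- Cutting off a `C¹` map that vanishes on a sphere leaves a Lipschitz map. -/
theorem lipschitz_indicator_closedBall {H : E → E} (hH : ContDiff ℝ 1 H) {R : ℝ}
    (h0 : ∀ x, ‖x‖ = R → H x = 0) :
    ∃ L : ℝ, 0 ≤ L ∧ ∀ x y, ‖(Metric.closedBall (0 : E) R).indicator H x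
      - (Metric.closedBall (0 : E) R).indicator H y‖ ≤ L * ‖x - y‖ := by
  have hcomp : IsCompact (Metric.closedBall (0 : E) R) := isCompact_closedBall 0 R
  obtain ⟨L, hL⟩ := hcomp.exists_bound_of_continuousOn
    ((hH.continuous_fderiv (by norm_num)).continuousOn (s := Metric.closedBall (0 : E) R))
  have hin : ∀ x ∈ Metric.closedBall (0 : E) R, ∀ y ∈ Metric.closedBall (0 : E) R,
      ‖H x - H y‖ ≤ max L 0 * ‖x - y‖ := fun x hx y hy => by
    refine (convex_closedBall (0 : E) R).norm_image_sub_le_of_norm_fderiv_le (𝕜 := ℝ)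
      (fun z _ => (hH.differentiable (by norm_num)) z) (fun z hz => (hL z hz).trans ?_) hy hx
    exact le_max_left _ _
  have hmix : ∀ x ∈ Metric.closedBall (0 : E) R, ∀ y ∉ Metric.closedBall (0 : E) R,
      ‖H x‖ ≤ max L 0 * ‖x - y‖ := fun x hx y hy => by
    have hx' : ‖x‖ ≤ R := by simpa using hx
    have hy' : R < ‖y‖ := by simpa using hy
    -- The segment from `x` to `y` crosses the sphere, where `H` vanishes; only its part inside the
    -- ball counts.
    have hc : ContinuousOn (fun s : ℝ => ‖x + s • (y - x)‖) (Icc 0 1) := by fun_prop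
    obtain ⟨s, hs, hsR⟩ := intermediate_value_Icc zero_le_one hc
      (show R ∈ Icc ‖x + (0 : ℝ) • (y - x)‖ ‖x + (1 : ℝ) • (y - x)‖ by simp [hx', hy'.le])
    have hz : x + s • (y - x) ∈ Metric.closedBall (0 : E) R := by
      simpa using hsR.le
    have h1 := hin x hx _ hz
    rw [h0 _ hsR, sub_zero] at h1
    refine h1.trans (mul_le_mul_of_nonneg_left ?_ (le_max_right _ _))
    rw [show x - (x + s • (y - x)) = s • (x - y) by rw [smul_sub, smul_sub]; abel, norm_smul,
      Real.norm_of_nonneg hs.1]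
    exact mul_le_of_le_one_left (norm_nonneg _) hs.2
  refine ⟨max L 0, le_max_right _ _, fun x y => ?_⟩
  by_cases hx : x ∈ Metric.closedBall (0 : E) R <;> by_cases hy : y ∈ Metric.closedBall (0 : E) R
  · simpa only [indicator_of_mem hx, indicator_of_mem hy] using hin x hx y hy
  · simpa only [indicator_of_mem hx, indicator_of_notMem hy, sub_zero] using hmix x hx y hy
  · rw [indicator_of_notMem hx, indicator_of_mem hy, zero_sub, norm_neg, norm_sub_rev x y]
    exact hmix y hy x hx
  · rw [indicator_of_notMem hx, indicator_of_notMem hy, sub_zero, norm_zero]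
    exact mul_nonneg (le_max_right _ _) (norm_nonneg _)

/-- The integral of the Jacobian over a ball depends on the boundary values only: for the
identity on the sphere, it is the volume of the ball. -/
theorem integral_det_one_add_fderiv [MeasurableSpace E] [BorelSpace E] {H : E → E}
    (hH : ContDiff ℝ 1 H) {R : ℝ} (h0 : ∀ x, ‖x‖ = R → H x = 0) :
    ∫ x in Metric.ball (0 : E) R, (1 + fderiv ℝ H x).det
      = (volume (Metric.ball (0 : E) R)).toReal := by
  set U := Metric.ball (0 : E) R
  have hcomp : IsCompact (Metric.closedBall (0 : E) R) := isCompact_closedBall 0 R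
  have hcd : Continuous (fderiv ℝ H) := hH.continuous_fderiv (by norm_num)
  have hdet : ∀ t : ℝ, Continuous fun x => (1 + t • fderiv ℝ H x).det := fun t =>
    ContinuousLinearMap.continuous_det.comp (by fun_prop)
  have hint : ∀ t : ℝ, IntegrableOn (fun x => (1 + t • fderiv ℝ H x).det) U := fun t =>
    ((hdet t).continuousOn.integrableOn_compact hcomp).mono_set Metric.ball_subset_closedBall
  obtain ⟨L, hL0, hL⟩ := lipschitz_indicator_closedBall hH h0
  obtain ⟨M, hM⟩ := hcomp.exists_bound_of_continuousOn hcd.continuousOn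
  obtain ⟨δ, hδ, hpos⟩ : ∃ δ > 0, ∀ A : E →L[ℝ] E, ‖A‖ < δ → 0 < (1 + A).det := by
    have hc : Continuous fun A : E →L[ℝ] E => (1 + A).det :=
      ContinuousLinearMap.continuous_det.comp (by fun_prop)
    have h1 : 0 < (1 + (0 : E →L[ℝ] E)).det := by
      rw [add_zero]
      simp [ContinuousLinearMap.det]
    obtain ⟨δ, hδ, h⟩ := Metric.eventually_nhds_iff.mp
      (hc.continuousAt.eventually (lt_mem_nhds h1))
    exact ⟨δ, hδ, fun A hA => h (by simpa using hA)⟩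
  -- Below `t₀`, `t L < 1` makes `x + t H` a bijective perturbation of the identity, and `t |M| < δ`
  -- keeps its Jacobian positive.
  set t₀ := min (1 / (L + 1)) (δ / (|M| + 1))
  have ht₀ : 0 < t₀ := lt_min (by positivity) (by positivity)
  have hkey : ∀ t : ℝ, 0 ≤ t → t < t₀ →
      ∫ x in U, (1 + t • fderiv ℝ H x).det = (volume U).toReal := fun t ht htt => by
    have htL : t * L < 1 := by
      have h1 : t < 1 / (L + 1) := htt.trans_le (min_le_left _ _)
      rw [lt_div_iff₀ (by positivity)] at h1
      linarith
    have htM : t * |M| < δ := by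
      have h1 : t < δ / (|M| + 1) := htt.trans_le (min_le_right _ _)
      rw [lt_div_iff₀ (by positivity)] at h1
      linarith
    set g : E → E := fun x => x + t • (Metric.closedBall (0 : E) R).indicator H x
    have hg : ApproximatesLinearOn g (ContinuousLinearEquiv.refl ℝ E : E →L[ℝ] E) univ
        (Real.toNNReal (t * L)) := fun x _ y _ => by
      have : g x - g y - (ContinuousLinearEquiv.refl ℝ E : E →L[ℝ] E) (x - y)
          = t • ((Metric.closedBall (0 : E) R).indicator H x
            - (Metric.closedBall (0 : E) R).indicator H y) := by
        simp only [g, smul_sub, ContinuousLinearEquiv.coe_refl, ContinuousLinearMap.coe_id', id]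
        abel
      rw [this, norm_smul, Real.norm_of_nonneg ht, Real.coe_toNNReal _ (by positivity), mul_assoc]
      exact mul_le_mul_of_nonneg_left (hL x y) ht
    have hbij : Function.Bijective g := by
      have hc : Subsingleton E ∨ Real.toNNReal (t * L) <
          ‖((ContinuousLinearEquiv.refl ℝ E).symm : E →L[ℝ] E)‖₊⁻¹ := by
        rcases subsingleton_or_nontrivial E with h | h
        · exact Or.inl h
        · right
          simp [Real.toNNReal_lt_one, htL]
      exact (hg.toHomeomorph g hc).bijective
    have hout : ∀ x ∉ U, g x = x := fun x hx => by
      have : R ≤ ‖x‖ := by simpa [U] using hx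
      rcases this.eq_or_lt with h | h
      · simp only [g]
        rw [indicator_of_mem (by simpa using h.ge), h0 x h.symm, smul_zero, add_zero]
      · simp only [g]
        rw [indicator_of_notMem (by simpa using h), smul_zero, add_zero]
    -- A bijection that is the identity off the ball maps the ball onto itself, so the change of
    -- variables computes its volume.
    have himg : g '' U = U := by
      apply Subset.antisymm
      · rintro _ ⟨x, hx, rfl⟩
        by_contra hgx
        exact hgx ((hbij.1 (hout _ hgx)).symm ▸ hx)
      · intro y hy
        obtain ⟨x, rfl⟩ := hbij.2 y
        by_contra hx
        have : x ∉ U := fun h => hx (mem_image_of_mem g h)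
        exact this (hout x this ▸ hy)
    have hderiv : ∀ x ∈ U, HasFDerivWithinAt g (1 + t • fderiv ℝ H x) U x := fun x hx => by
      have h1 : HasFDerivAt (fun x => x + t • H x) (1 + t • fderiv ℝ H x) x :=
        (hasFDerivAt_id x).add (((hH.differentiable (by norm_num)) x).hasFDerivAt.const_smul t)
      refine h1.hasFDerivWithinAt.congr (fun y hy => ?_) ?_
      · simp only [g]; rw [indicator_of_mem (Metric.ball_subset_closedBall hy)]
      · simp only [g]; rw [indicator_of_mem (Metric.ball_subset_closedBall hx)]
    have hcv := integral_image_eq_integral_abs_det_fderiv_smul volume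
      Metric.isOpen_ball.measurableSet hderiv hbij.1.injOn (fun _ => (1 : ℝ))
    rw [himg] at hcv
    simp only [smul_eq_mul, mul_one, integral_const, measureReal_restrict_apply_univ] at hcv
    rw [← Measure.real, hcv]
    refine setIntegral_congr_fun Metric.isOpen_ball.measurableSet fun x hx => ?_
    refine (abs_of_pos (hpos _ ?_)).symm
    rw [norm_smul, Real.norm_of_nonneg ht]
    refine lt_of_le_of_lt (mul_le_mul_of_nonneg_left ?_ ht) htM
    exact (hM x (Metric.ball_subset_closedBall hx)).trans (le_abs_self M)
  -- The integral is constant for small `t` and polynomial in `t`; interpolation carries the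
  -- constant to `t = 1`.
  obtain ⟨s, c, hs, hc1, hc⟩ := exists_interpolation_det E ht₀
  calc ∫ x in U, (1 + fderiv ℝ H x).det
      = ∫ x in U, ∑ t ∈ s, c t * (1 + t • fderiv ℝ H x).det := by simp_rw [← hc]
    _ = ∑ t ∈ s, c t * ∫ x in U, (1 + t • fderiv ℝ H x).det := by
        rw [integral_finsetSum _ fun t _ => (hint t).const_mul (c t)]
        simp_rw [integral_const_mul]
    _ = ∑ t ∈ s, c t * (volume U).toReal :=
        Finset.sum_congr rfl fun t ht => by rw [hkey t (hs t ht).1 (hs t ht).2]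
    _ = (volume U).toReal := by rw [← Finset.sum_mul, hc1, one_mul]

/-- A `C¹` map of constant norm has a singular derivative. -/
theorem det_fderiv_eq_zero_of_norm_eq_const {N : E → E} (hN : Differentiable ℝ N) {R : ℝ}
    (hR : 0 < R) (h : ∀ x, ‖N x‖ = R) (x : E) : (fderiv ℝ N x).det = 0 := by
  by_contra hdet
  have hsurj : Function.Surjective (fderiv ℝ N x) := by
    have hu : IsUnit ((fderiv ℝ N x : E →L[ℝ] E) : E →ₗ[ℝ] E) :=
      (LinearMap.isUnit_iff_isUnit_det _).mpr (isUnit_iff_ne_zero.mpr hdet)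
    exact ((Module.End.isUnit_iff _).mp hu).2
  obtain ⟨v, hv⟩ := hsurj (N x)
  -- Differentiating the constant `‖N‖²` shows that the range of the derivative is orthogonal to `N
  -- x`; surjectivity would then force `N x = 0`.
  have h1 : HasFDerivAt (fun y => ‖N y‖ ^ 2) (2 • (innerSL ℝ (N x)).comp (fderiv ℝ N x)) x :=
    (hN x).hasFDerivAt.norm_sq
  simp_rw [h] at h1
  have h2 := h1.unique (hasFDerivAt_const (R ^ 2) x)
  have h3 := congrArg (fun A : E →L[ℝ] ℝ => A v) h2
  simp [hv] at h3
  have := h x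
  rw [h3, norm_zero] at this
  exact hR.ne this

/-- Brouwer's theorem as a zero lemma: a continuous vector field that points outwards on a sphere
vanishes in the ball. -/
theorem exists_zero_of_inner_pos {F : E → E} (hF : Continuous F) {R : ℝ} (hR : 0 < R)
    (hpos : ∀ x, ‖x‖ = R → 0 < inner ℝ (F x) x) : ∃ x, ‖x‖ ≤ R ∧ F x = 0 := by
  by_contra! hne
  borelize E
  have hcb : IsCompact (Metric.closedBall (0 : E) R) := isCompact_closedBall 0 R
  have hcs : IsCompact (Metric.sphere (0 : E) R) := isCompact_sphere 0 R
  obtain ⟨m, hm, hmF⟩ : ∃ m > 0, ∀ x, ‖x‖ ≤ R → m ≤ ‖F x‖ := by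
    obtain ⟨x, hx, hmin⟩ := hcb.exists_isMinOn ⟨0, by simp [hR.le]⟩ hF.norm.continuousOn
    exact ⟨‖F x‖, norm_pos_iff.mpr (hne x (by simpa using hx)), fun y hy =>
      hmin (show y ∈ Metric.closedBall (0 : E) R by simpa using hy)⟩
  obtain ⟨k, hk, hkF⟩ : ∃ k > 0, ∀ x, ‖x‖ = R → k ≤ inner ℝ (F x) x := by
    rcases (Metric.sphere (0 : E) R).eq_empty_or_nonempty with he | he
    · refine ⟨1, one_pos, fun x hx => ?_⟩
      have : x ∈ Metric.sphere (0 : E) R := by simpa using hx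
      simp [he] at this
    · obtain ⟨x, hx, hmin⟩ := hcs.exists_isMinOn he
        (f := fun x => inner ℝ (F x) x) (by fun_prop)
      exact ⟨_, hpos x (by simpa using hx), fun y hy =>
        hmin (show y ∈ Metric.sphere (0 : E) R by simpa using hy)⟩
  -- Tolerance `m` keeps `G` from vanishing in the ball; tolerance `k / R` keeps it pointing
  -- outwards on the sphere.
  obtain ⟨G, hG, hGF⟩ : ∃ G : E → E, ContDiff ℝ 1 G ∧ ∀ x, ‖G x - F x‖ < min m (k / R) := by
    obtain ⟨G, hG, h, -⟩ := hF.exists_contDiff_approx 1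
      (continuous_const (y := min m (k / R))) fun _ => lt_min hm (div_pos hk hR)
    exact ⟨G, hG, fun x => by simpa only [dist_eq_norm] using h x⟩
  have hG0 : ∀ x, ‖x‖ ≤ R → G x ≠ 0 := fun x hx h0 => by
    have h1 := (hGF x).trans_le (min_le_left _ _)
    rw [h0, zero_sub, norm_neg] at h1
    exact absurd (hmF x hx) (not_le.mpr h1)
  have hGpos : ∀ x, ‖x‖ = R → 0 < inner ℝ (G x) x := fun x hx => by
    have h1 := (hGF x).trans_le (min_le_right _ _)
    rw [lt_div_iff₀ hR] at h1
    have h2 := (abs_le.mp (abs_real_inner_le_norm (G x - F x) x)).1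
    rw [hx, inner_sub_left] at h2
    linarith [hkF x hx]
  obtain ⟨χ, hχ, hχ01, hχA, hχB⟩ : ∃ χ : E → ℝ, ContDiff ℝ 1 χ ∧ (∀ x, 0 ≤ χ x ∧ χ x ≤ 1) ∧
      (∀ x, R ≤ ‖x‖ → χ x = 1) ∧ ∀ x, ‖x‖ ≤ R → inner ℝ (G x) x ≤ 0 → χ x = 0 := by
    have hGc := hG.continuous
    obtain ⟨χ, h0, h1, h01⟩ := exists_contMDiffMap_zero_one_of_isClosed
      (modelWithCornersSelf ℝ E) (n := 1)
      (s := {x : E | ‖x‖ ≤ R} ∩ {x : E | inner ℝ (G x) x ≤ 0}) (t := {x : E | R ≤ ‖x‖})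
      ((isClosed_le (by fun_prop) (by fun_prop)).inter (isClosed_le (by fun_prop) (by fun_prop)))
      (isClosed_le (by fun_prop) (by fun_prop))
      (Set.disjoint_left.mpr fun x hx hx' => (hGpos x (le_antisymm hx.1 hx')).not_ge hx.2)
    exact ⟨χ, χ.contMDiff.contDiff, h01, fun x hx => h1 hx, fun x hx hi => h0 ⟨hx, hi⟩⟩
  -- Inside the ball, `G` is blended with the identity only where both have positive inner product
  -- with `x`, so `f` has no zero.
  set f : E → E := fun x => χ x • x + (1 - χ x) • G x
  have hf : ContDiff ℝ 1 f := by fun_prop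
  have hf0 : ∀ x, f x ≠ 0 := fun x hfx => by
    rcases le_or_gt R ‖x‖ with hx | hx
    · simp only [f, hχA x hx, one_smul, sub_self, zero_smul, add_zero] at hfx
      rw [hfx, norm_zero] at hx
      exact absurd hx (not_le.mpr hR)
    · rcases le_or_gt (inner ℝ (G x) x) 0 with hi | hi
      · simp only [f, hχB x hx.le hi, zero_smul, sub_zero, one_smul, zero_add] at hfx
        exact hG0 x hx.le hfx
      · have h1 : inner ℝ (f x) x = χ x * ‖x‖ ^ 2 + (1 - χ x) * inner ℝ (G x) x := by
          simp only [f, inner_add_left, real_inner_smul_left, real_inner_self_eq_norm_sq]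
        rw [hfx, inner_zero_left] at h1
        have hx0 : 0 < ‖x‖ := norm_pos_iff.mpr fun h => by simp [h] at hi
        rcases (hχ01 x).1.eq_or_lt with h | h
        · rw [← h] at h1
          linarith
        · nlinarith [mul_pos h (pow_pos hx0 2), mul_nonneg (sub_nonneg.mpr (hχ01 x).2) hi.le]
  set N : E → E := fun x => (R / ‖f x‖) • f x
  have hN : ContDiff ℝ 1 N :=
    (contDiff_const.div (hf.norm ℝ hf0) fun x => norm_ne_zero_iff.mpr (hf0 x)).smul hf
  have hNR : ∀ x, ‖N x‖ = R := fun x => by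
    have := norm_ne_zero_iff.mpr (hf0 x)
    simp only [N, norm_smul, norm_div, norm_norm, Real.norm_of_nonneg hR.le]
    field_simp
  have hdeg := integral_det_one_add_fderiv (H := fun x => N x - x) (hN.sub contDiff_id) (R := R)
    fun x hx => by
      have : f x = x := by
        simp only [f, hχA x hx.ge, one_smul, sub_self, zero_smul, add_zero]
      simp only [N, this, hx, div_self hR.ne', one_smul, sub_self]
  have hz : ∀ x, (1 + fderiv ℝ (fun x => N x - x) x).det = 0 := fun x => by
    have hNd := hN.differentiable (by norm_num)
    have : fderiv ℝ (fun x => N x - x) x = fderiv ℝ N x - 1 :=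
      ((hNd x).hasFDerivAt.sub (hasFDerivAt_id x)).fderiv
    rw [this, add_sub_cancel]
    exact det_fderiv_eq_zero_of_norm_eq_const hNd hR hNR x
  simp only [hz, integral_zero] at hdeg
  have := ENNReal.toReal_pos (Metric.measure_ball_pos volume (0 : E) hR).ne'
    measure_ball_lt_top.ne
  exact this.ne hdeg

theorem continuous_of_continuous_inner {X : Type*} [TopologicalSpace X] {f : X → E}
    (hf : ∀ ξ, Continuous fun x => (inner ℝ (f x) ξ : ℝ)) : Continuous f := by
  set b := stdOrthonormalBasis ℝ E
  have : f = fun x => ∑ i, (inner ℝ (f x) (b i) : ℝ) • b i := by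
    funext x
    exact (b.sum_repr' (f x)).symm.trans
      (Finset.sum_congr rfl fun i _ => by rw [real_inner_comm])
  rw [this]
  exact continuous_finsetSum _ fun i _ => (hf (b i)).smul continuous_const

/-- Existence for a system that couples a coercive nonlinearity `g` with a family `b` of positive
semidefinite forms, which need not be definite. -/
theorem exists_solution_of_coercive (g : E → E →ₗ[ℝ] ℝ) (b : E → E → E →ₗ[ℝ] ℝ)
    (hg : ∀ ξ, Continuous fun φ => g φ ξ)
    (hb : ∀ ψ, Continuous fun z : E × E => b z.1 z.2 ψ)
    (hpos : ∀ φ υ, 0 ≤ b φ υ υ) (φ₀ : E) {R : ℝ}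
    (hR : ∀ x, g (φ₀ + x) x ≤ 0 → ‖x‖ ≤ R) :
    ∃ φ υ : E, (∀ ψ, inner ℝ (φ - φ₀) ψ + b φ υ ψ = 0) ∧ ∀ ξ, inner ℝ υ ξ = g φ ξ := by
  set G : E → E := fun φ =>
    (InnerProductSpace.toDual ℝ E).symm (LinearMap.toContinuousLinearMap (g φ))
  set B : E → E → E := fun φ υ =>
    (InnerProductSpace.toDual ℝ E).symm (LinearMap.toContinuousLinearMap (b φ υ))
  have hGi : ∀ φ ξ, inner ℝ (G φ) ξ = g φ ξ := fun φ ξ => by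
    simp only [G, InnerProductSpace.toDual_symm_apply]
    rfl
  have hBi : ∀ φ υ ξ, inner ℝ (B φ υ) ξ = b φ υ ξ := fun φ υ ξ => by
    simp only [B, InnerProductSpace.toDual_symm_apply]
    rfl
  have hGc : Continuous G := continuous_of_continuous_inner fun ξ => by
    simpa only [hGi] using hg ξ
  have hBc : Continuous fun z : E × E => B z.1 z.2 := continuous_of_continuous_inner fun ξ => by
    simpa only [hBi] using hb ξ
  have hreg : ∀ ε : ℝ, 0 < ε → ∃ x, ‖x‖ ≤ R ∧
      x + B (φ₀ + x) (G (φ₀ + x)) + ε • G (φ₀ + x) = 0 := fun ε hε => by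
    obtain ⟨m, hm0, hm⟩ : ∃ m : ℝ, 0 ≤ m ∧ ∀ x, ‖x‖ ≤ R → -m ≤ g (φ₀ + x) x := by
      have hc : Continuous fun x => (inner ℝ (G (φ₀ + x)) x : ℝ) := by fun_prop
      obtain ⟨m, hm⟩ := (isCompact_closedBall (0 : E) R).exists_bound_of_continuousOn
        hc.continuousOn
      refine ⟨max m 0, le_max_right _ _, fun x hx => ?_⟩
      have h1 := hm x (by simpa using hx)
      rw [hGi, Real.norm_eq_abs] at h1
      exact (neg_le_neg (h1.trans (le_max_left _ _))).trans (neg_abs_le _)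
    -- The signs are chosen so that `-υ` in the first component and `x` in the second cancel when
    -- paired with `(x, υ)`.
    set H : WithLp 2 (E × E) → WithLp 2 (E × E) := fun z => WithLp.toLp 2
      (G (φ₀ + z.fst) - z.snd, z.fst + B (φ₀ + z.fst) z.snd + ε • z.snd)
    have hHi : ∀ z, inner ℝ (H z) z
        = g (φ₀ + z.fst) z.fst + b (φ₀ + z.fst) z.snd z.snd + ε * ‖z.snd‖ ^ 2 := fun z => by
      rw [WithLp.prod_inner_apply]
      change inner ℝ (G (φ₀ + z.fst) - z.snd) z.fst
        + inner ℝ (z.fst + B (φ₀ + z.fst) z.snd + ε • z.snd) z.snd = _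
      rw [inner_sub_left, inner_add_left, inner_add_left, hGi, hBi, real_inner_smul_left,
        real_inner_self_eq_norm_sq, real_inner_comm z.snd z.fst]
      ring
    have hHc : Continuous H := by
      have h1 : Continuous fun z : WithLp 2 (E × E) => z.fst := by fun_prop
      have h2 : Continuous fun z : WithLp 2 (E × E) => z.snd := by fun_prop
      have h3 : Continuous fun z : WithLp 2 (E × E) => B (φ₀ + z.fst) z.snd :=
        hBc.comp ((continuous_const.add h1).prodMk h2)
      refine (WithLp.prod_continuous_toLp 2 E E).comp ?_
      fun_prop
    -- On this sphere either `‖x‖ > R`, where `g` is positive, or `‖υ‖² ≥ m / ε + 1`, where `ε ‖υ‖²`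
    -- exceeds the deficit `m`.
    have hpos' : 0 < R ^ 2 + m / ε + 1 := by positivity
    obtain ⟨z, -, hz⟩ := exists_zero_of_inner_pos hHc (Real.sqrt_pos.mpr hpos') fun z hz => by
      have hz2 : ‖z.fst‖ ^ 2 + ‖z.snd‖ ^ 2 = R ^ 2 + m / ε + 1 := by
        rw [← WithLp.prod_norm_sq_eq_of_L2, hz, Real.sq_sqrt hpos'.le]
      rw [hHi]
      rcases le_or_gt ‖z.fst‖ R with h | h
      · have h1 : ‖z.fst‖ ^ 2 ≤ R ^ 2 := pow_le_pow_left₀ (norm_nonneg _) h 2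
        have h2 : ε * (m / ε + 1) ≤ ε * ‖z.snd‖ ^ 2 :=
          mul_le_mul_of_nonneg_left (by linarith) hε.le
        rw [mul_add, mul_div_cancel₀ _ hε.ne', mul_one] at h2
        linarith [hm _ h, hpos (φ₀ + z.fst) z.snd]
      · have h1 : 0 < g (φ₀ + z.fst) z.fst := by
          by_contra! h'
          exact absurd (hR _ h') (not_le.mpr h)
        have := hpos (φ₀ + z.fst) z.snd
        positivity
    -- The radius of the sphere depends on `ε`. At a zero, however, the pairing gives `g(φ₀ + x)(x)
    -- ≤ 0`, which bounds `x` by `R` alone.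
    have hi := hHi z
    rw [hz, inner_zero_left] at hi
    have h1 : G (φ₀ + z.fst) - z.snd = 0 := congrArg WithLp.fst hz
    have h2 : z.fst + B (φ₀ + z.fst) z.snd + ε • z.snd = 0 := congrArg WithLp.snd hz
    rw [← sub_eq_zero.mp h1] at h2
    refine ⟨z.fst, hR _ ?_, h2⟩
    have := hpos (φ₀ + z.fst) z.snd
    have : 0 ≤ ε * ‖z.snd‖ ^ 2 := by positivity
    linarith
  choose x hxR hx using fun n : ℕ => hreg (1 / ((n : ℝ) + 1)) Nat.one_div_pos_of_nat
  obtain ⟨y, -, θ, hθ, hlim⟩ := (isCompact_closedBall (0 : E) R).tendsto_subseq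
    (x := x) fun n => by simpa using hxR n
  have hK : Continuous fun z : E × ℝ =>
      z.1 + B (φ₀ + z.1) (G (φ₀ + z.1)) + z.2 • G (φ₀ + z.1) := by
    have h3 : Continuous fun z : E × ℝ => B (φ₀ + z.1) (G (φ₀ + z.1)) :=
      hBc.comp (f := fun z : E × ℝ => (φ₀ + z.1, G (φ₀ + z.1))) (by fun_prop)
    fun_prop
  have hlim' := (hK.tendsto (y, 0)).comp (hlim.prodMk_nhds
    ((tendsto_one_div_add_atTop_nhds_zero_nat (𝕜 := ℝ)).comp hθ.tendsto_atTop))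
  have hy : y + B (φ₀ + y) (G (φ₀ + y)) = 0 := by
    have h0 := tendsto_nhds_unique hlim' (tendsto_const_nhds.congr fun n => (hx (θ n)).symm)
    simpa using h0
  refine ⟨φ₀ + y, G (φ₀ + y), fun ψ => ?_, fun ξ => hGi _ _⟩
  rw [← hBi, ← inner_add_left, add_sub_cancel_left, hy, inner_zero_left]

end ZeroLemma

/-! ### Polynomials of bounded degree and inverse inequalities -/

section Polynomials

variable {d : ℕ}

theorem continuous_eval_space (q : MvPolynomial (Fin d) ℝ) :
    Continuous fun x : EuclideanSpace ℝ (Fin d) => MvPolynomial.eval (fun k => x k) q :=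
  (MvPolynomial.continuous_eval q).comp (by fun_prop)

/-- Expansion in a basis gives joint continuity in polynomial and point, as needed for integrals
depending on the polynomial. -/
theorem continuous_eval_linearMap {V : Type*} [NormedAddCommGroup V] [NormedSpace ℝ V]
    [FiniteDimensional ℝ V] (A : V →ₗ[ℝ] MvPolynomial (Fin d) ℝ) :
    Continuous fun z : V × EuclideanSpace ℝ (Fin d) =>
      MvPolynomial.eval (fun k => z.2 k) (A z.1) := by
  set b := Module.finBasis ℝ V
  have h : ∀ z : V × EuclideanSpace ℝ (Fin d), MvPolynomial.eval (fun k => z.2 k) (A z.1)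
      = ∑ i, b.coord i z.1 * MvPolynomial.eval (fun k => z.2 k) (A (b i)) := fun z => by
    conv_lhs => rw [← b.sum_repr z.1]
    simp only [map_sum, map_smul, MvPolynomial.smul_eval, Module.Basis.coord_apply]
  simp_rw [h]
  exact continuous_finsetSum _ fun i _ =>
    ((b.coord i).continuous_of_finiteDimensional.comp continuous_fst).mul
      ((continuous_eval_space _).comp continuous_snd)

/-- A polynomial that vanishes on a non-empty open set is zero. -/
theorem MvPolynomial.eq_zero_of_eval_eq_zero_on_open {q : MvPolynomial (Fin d) ℝ}
    {U : Set (EuclideanSpace ℝ (Fin d))} (hU : IsOpen U) (hne : U.Nonempty)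
    (h : ∀ x ∈ U, MvPolynomial.eval (fun k => x k) q = 0) : q = 0 := by
  obtain ⟨a, ha⟩ := hne
  have hU' : IsOpen ((fun y : Fin d → ℝ => (WithLp.toLp 2 y : EuclideanSpace ℝ (Fin d))) ⁻¹' U) :=
    hU.preimage (PiLp.continuous_toLp 2 _)
  obtain ⟨ε, hε, hball⟩ := Metric.isOpen_iff.mp hU' (fun k => a k) ha
  refine MvPolynomial.funext_set (fun k => Metric.ball (a k) ε) (fun k => ?_) fun y hy => ?_
  · rw [Real.ball_eq_Ioo]
    exact Set.Ioo_infinite (by linarith)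
  · have hy' : y ∈ Metric.ball (fun k => a k) ε := by
      rw [← ball_pi _ hε] at *
      exact hy
    rw [map_zero]
    exact h _ (hball hy')

/-- The `L²` norm over a set with non-empty interior is definite on polynomials. -/
theorem MvPolynomial.eq_zero_of_setIntegral_sq_eq_zero {q : MvPolynomial (Fin d) ℝ}
    {K : Set (EuclideanSpace ℝ (Fin d))} (hK : IsCompact K) (hne : (interior K).Nonempty)
    (h : ∫ x in K, MvPolynomial.eval (fun k => x k) q * MvPolynomial.eval (fun k => x k) q = 0) :
    q = 0 := by
  have hc := continuous_eval_space q
  rw [integral_eq_zero_iff_of_nonneg (fun x => mul_self_nonneg _)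
    ((hc.mul hc).continuousOn.integrableOn_compact hK)] at h
  have h2 := ae_restrict_of_ae_restrict_of_subset interior_subset h
  have h3 := Measure.eqOn_open_of_ae_eq h2 isOpen_interior (hc.mul hc).continuousOn
    continuousOn_const
  exact MvPolynomial.eq_zero_of_eval_eq_zero_on_open isOpen_interior hne fun x hx =>
    mul_self_eq_zero.mp (h3 hx)

/-- On polynomials of bounded degree, the supremum norm on a ball is controlled by the `L²` norm on
the unit ball. -/
theorem exists_eval_sq_le_integral_unitBall (d p : ℕ) (κ : ℝ) :
    ∃ C : ℝ, 0 ≤ C ∧ ∀ q : MvPolynomial (Fin d) ℝ, q.totalDegree ≤ p →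
      ∀ z : EuclideanSpace ℝ (Fin d), ‖z‖ ≤ κ → MvPolynomial.eval (fun k => z k) q ^ 2
        ≤ C * ∫ x in Metric.closedBall (0 : EuclideanSpace ℝ (Fin d)) 1,
          MvPolynomial.eval (fun k => x k) q ^ 2 := by
  set K := Metric.closedBall (0 : EuclideanSpace ℝ (Fin d)) 1
  have hK : IsCompact K := isCompact_closedBall _ _
  have hKi : (interior K).Nonempty :=
    ⟨0, Metric.ball_subset_interior_closedBall (Metric.mem_ball_self one_pos)⟩
  let W := MvPolynomial.restrictTotalDegree (Fin d) ℝ p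
  have hint : ∀ q r : MvPolynomial (Fin d) ℝ, IntegrableOn (fun x : EuclideanSpace ℝ (Fin d) =>
      MvPolynomial.eval (fun k => x k) q * MvPolynomial.eval (fun k => x k) r) K := fun q r =>
    ((continuous_eval_space q).mul (continuous_eval_space r)).continuousOn.integrableOn_compact hK
  let core : InnerProductSpace.Core ℝ W :=
    { inner := fun q r => ∫ x in K, MvPolynomial.eval (fun k => x k) (q : MvPolynomial (Fin d) ℝ)
        * MvPolynomial.eval (fun k => x k) (r : MvPolynomial (Fin d) ℝ)
      conj_inner_symm := fun q r => by
        simp only [conj_trivial]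
        exact integral_congr_ae (.of_forall fun x => mul_comm _ _)
      re_inner_nonneg := fun q => integral_nonneg fun x => mul_self_nonneg _
      add_left := fun q r s => by
        rw [← integral_add (hint _ _) (hint _ _)]
        simp [add_mul]
      smul_left := fun q r c => by
        simp only [conj_trivial]
        rw [← integral_const_mul]
        simp [MvPolynomial.smul_eval, mul_assoc]
      definite := fun q hq =>
        Subtype.ext (MvPolynomial.eq_zero_of_setIntegral_sq_eq_zero hK hKi hq) }
  let _ : NormedAddCommGroup W := core.toNormedAddCommGroup
  let _ : InnerProductSpace ℝ W := InnerProductSpace.ofCore core.toCore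
  set b := stdOrthonormalBasis ℝ W
  -- In an orthonormal basis `|q(z)| ≤ ‖q‖ ∑ |bᵢ(z)|`, and `M` bounds this sum over the ball of
  -- radius `κ`.
  obtain ⟨M, hM⟩ := (isCompact_closedBall (0 : EuclideanSpace ℝ (Fin d)) κ).exists_bound_of_continuousOn
    (f := fun z => ∑ i, |MvPolynomial.eval (fun k => z k) (b i : MvPolynomial (Fin d) ℝ)|)
    (continuous_finsetSum _ fun i _ => (continuous_eval_space _).abs).continuousOn
  refine ⟨M ^ 2, sq_nonneg _, fun q hq z hz => ?_⟩
  let q' : W := ⟨q, (MvPolynomial.mem_restrictTotalDegree _ _ _).mpr hq⟩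
  have hnorm : ‖q'‖ ^ 2 = ∫ x in K, MvPolynomial.eval (fun k => x k) q ^ 2 := by
    rw [← real_inner_self_eq_norm_sq]
    simp_rw [sq]
    rfl
  have hrep : MvPolynomial.eval (fun k => z k) q = ∑ i, (inner ℝ (b i) q' : ℝ) *
      MvPolynomial.eval (fun k => z k) (b i : MvPolynomial (Fin d) ℝ) := by
    have h1 : q = ((∑ i, (inner ℝ (b i) q' : ℝ) • b i : W) : MvPolynomial (Fin d) ℝ) := by
      rw [b.sum_repr']
    conv_lhs => rw [h1]
    simp [MvPolynomial.smul_eval]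
  have habs : |MvPolynomial.eval (fun k => z k) q| ≤ M * ‖q'‖ := by
    rw [hrep]
    refine (Finset.abs_sum_le_sum_abs _ _).trans ?_
    calc ∑ i, |(inner ℝ (b i) q' : ℝ) * MvPolynomial.eval (fun k => z k) (b i).1|
        ≤ ∑ i, ‖q'‖ * |MvPolynomial.eval (fun k => z k) (b i).1| := by
          refine Finset.sum_le_sum fun i _ => ?_
          rw [abs_mul]
          refine mul_le_mul_of_nonneg_right ?_ (abs_nonneg _)
          have := abs_real_inner_le_norm (b i) q'
          rwa [b.norm_eq_one, one_mul] at this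
      _ ≤ M * ‖q'‖ := by
          rw [← Finset.mul_sum, mul_comm]
          refine mul_le_mul_of_nonneg_right ((le_abs_self _).trans (hM z (by simpa using hz)))
            (norm_nonneg _)
  rw [← hnorm, ← mul_pow, ← sq_abs]
  exact pow_le_pow_left₀ (abs_nonneg _) habs 2

/-- Affine substitution does not raise the total degree. -/
theorem MvPolynomial.exists_eval_affine (q : MvPolynomial (Fin d) ℝ) (a : Fin d → ℝ) (ρ : ℝ) :
    ∃ r : MvPolynomial (Fin d) ℝ, r.totalDegree ≤ q.totalDegree ∧
      ∀ z : Fin d → ℝ, MvPolynomial.eval z r = MvPolynomial.eval (fun k => a k + ρ * z k) q := by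
  refine ⟨MvPolynomial.bind₁
    (fun k => MvPolynomial.C (a k) + MvPolynomial.C ρ * MvPolynomial.X k) q, ?_, fun z => ?_⟩
  · have hX : ∀ k : Fin d, (MvPolynomial.C (a k) + MvPolynomial.C ρ * MvPolynomial.X k :
        MvPolynomial (Fin d) ℝ).totalDegree ≤ 1 := fun k => by
      refine (MvPolynomial.totalDegree_add _ _).trans (max_le (by simp) ?_)
      refine (MvPolynomial.totalDegree_mul _ _).trans ?_
      simp
    conv_lhs => rw [q.as_sum, map_sum]
    refine MvPolynomial.totalDegree_finsetSum_le fun m hm => ?_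
    rw [MvPolynomial.bind₁_monomial]
    refine (MvPolynomial.totalDegree_mul _ _).trans ?_
    rw [MvPolynomial.totalDegree_C, zero_add]
    refine (MvPolynomial.totalDegree_finsetProd _ _).trans ?_
    refine le_trans ?_ (MvPolynomial.le_totalDegree hm)
    refine Finset.sum_le_sum fun k _ => ?_
    refine (MvPolynomial.totalDegree_pow _ _).trans ?_
    exact (Nat.mul_le_mul_left _ (hX k)).trans (mul_one _).le
  · simp only [← MvPolynomial.coe_aeval_eq_eval, RingHom.coe_coe, MvPolynomial.aeval_bind₁]
    simp

theorem MvPolynomial.totalDegree_pderiv_le (q : MvPolynomial (Fin d) ℝ) (k : Fin d) :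
    (MvPolynomial.pderiv k q).totalDegree ≤ q.totalDegree := by
  conv_lhs => rw [q.as_sum, map_sum]
  refine MvPolynomial.totalDegree_finsetSum_le fun m hm => ?_
  rw [MvPolynomial.pderiv_monomial]
  refine (MvPolynomial.totalDegree_monomial_le _ _).trans ?_
  refine le_trans ?_ (MvPolynomial.le_totalDegree hm)
  exact Finsupp.degree_mono tsub_le_self

theorem setIntegral_closedBall_eq (f : EuclideanSpace ℝ (Fin d) → ℝ)
    (x₀ : EuclideanSpace ℝ (Fin d)) {ρ : ℝ} (hρ : 0 < ρ) :
    ∫ z in Metric.closedBall (0 : EuclideanSpace ℝ (Fin d)) 1, f (x₀ + ρ • z)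
      = (ρ ^ d)⁻¹ * ∫ x in Metric.closedBall x₀ ρ, f x := by
  rw [Measure.setIntegral_comp_smul_of_pos volume (fun x => f (x₀ + x)) _ hρ,
    smul_closedBall _ _ zero_le_one, smul_zero, Real.norm_of_nonneg hρ.le, mul_one,
    finrank_euclideanSpace_fin, smul_eq_mul]
  congr 1
  have h := (measurePreserving_add_left volume x₀).setIntegral_preimage_emb
    (measurableEmbedding_addLeft x₀) f (Metric.closedBall x₀ ρ)
  rw [← h]
  congr 2
  ext x
  simp

/-- The inverse inequality between the supremum and the `L²` mean on shape-regular sets. -/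
theorem exists_eval_sq_mul_volume_le (d p : ℕ) (κ : ℝ) :
    ∃ C : ℝ, 0 ≤ C ∧ ∀ q : MvPolynomial (Fin d) ℝ, q.totalDegree ≤ p →
      ∀ (K : Set (EuclideanSpace ℝ (Fin d))) (x₀ : EuclideanSpace ℝ (Fin d)) (ρ : ℝ),
        0 < ρ → IsCompact K → Metric.closedBall x₀ ρ ⊆ K → Metric.diam K ≤ κ * ρ →
        ∀ y ∈ K, MvPolynomial.eval (fun k => y k) q ^ 2 * (volume K).toReal
          ≤ C * ∫ x in K, MvPolynomial.eval (fun k => x k) q ^ 2 := by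
  obtain ⟨C, hC0, hC⟩ := exists_eval_sq_le_integral_unitBall d p κ
  set ω := (volume (Metric.ball (0 : EuclideanSpace ℝ (Fin d)) 1)).toReal
  have hω : 0 ≤ ω := ENNReal.toReal_nonneg
  -- The factor `ρ^(-d)` from scaling to the unit ball cancels against `|K| ≤ (κ ρ)^d ω`. The
  -- absolute value only serves negative `κ`, for which no such `K` exists.
  refine ⟨C * |κ| ^ d * ω, by positivity, fun q hq K x₀ ρ hρ hK hball hdiam y hy => ?_⟩
  have hx₀ : x₀ ∈ K := hball (Metric.mem_closedBall_self hρ.le)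
  have hdist : ∀ x ∈ K, dist x x₀ ≤ κ * ρ := fun x hx =>
    (Metric.dist_le_diam_of_mem hK.isBounded hx hx₀).trans hdiam
  have hκ : 0 ≤ κ := nonneg_of_mul_nonneg_left (Metric.diam_nonneg.trans hdiam) hρ
  rw [abs_of_nonneg hκ]
  obtain ⟨r, hr, hre⟩ := MvPolynomial.exists_eval_affine q (fun k => x₀ k) ρ
  have hre' : ∀ z : EuclideanSpace ℝ (Fin d), MvPolynomial.eval (fun k => z k) r
      = MvPolynomial.eval (fun k => (x₀ + ρ • z) k) q := fun z => by
    rw [hre]; rfl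
  have hqc := continuous_eval_space q
  have hvol : (volume K).toReal ≤ (κ * ρ) ^ d * ω := by
    have h1 : K ⊆ Metric.closedBall x₀ (κ * ρ) := fun x hx => hdist x hx
    have h2 := ENNReal.toReal_mono measure_closedBall_lt_top.ne (measure_mono (μ := volume) h1)
    rwa [Measure.addHaar_closedBall _ _ (mul_nonneg hκ hρ.le), ENNReal.toReal_mul,
      ENNReal.toReal_ofReal (by positivity), finrank_euclideanSpace_fin] at h2
  have hsup : MvPolynomial.eval (fun k => y k) q ^ 2 ≤ C * ((ρ ^ d)⁻¹ *
      ∫ x in K, MvPolynomial.eval (fun k => x k) q ^ 2) := by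
    have h1 := hC r (hr.trans hq) (ρ⁻¹ • (y - x₀)) (by
      rw [norm_smul, norm_inv, Real.norm_of_nonneg hρ.le, inv_mul_le_iff₀ hρ, ← dist_eq_norm,
        mul_comm]
      exact hdist y hy)
    simp_rw [hre'] at h1
    rw [smul_inv_smul₀ hρ.ne', add_sub_cancel, setIntegral_closedBall_eq
      (fun x => MvPolynomial.eval (fun k => x k) q ^ 2) x₀ hρ] at h1
    refine h1.trans ?_
    have hmono : ∫ x in Metric.closedBall x₀ ρ, MvPolynomial.eval (fun k => x k) q ^ 2
        ≤ ∫ x in K, MvPolynomial.eval (fun k => x k) q ^ 2 :=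
      setIntegral_mono_set ((hqc.pow 2).continuousOn.integrableOn_compact hK)
        (.of_forall fun x => sq_nonneg _) hball.eventuallyLE
    gcongr
  have hI : 0 ≤ ∫ x in K, MvPolynomial.eval (fun k => x k) q ^ 2 :=
    integral_nonneg fun x => sq_nonneg _
  calc MvPolynomial.eval (fun k => y k) q ^ 2 * (volume K).toReal
      ≤ (C * ((ρ ^ d)⁻¹ * ∫ x in K, MvPolynomial.eval (fun k => x k) q ^ 2))
          * ((κ * ρ) ^ d * ω) := by
        gcongr
    _ = C * κ ^ d * ω * ∫ x in K, MvPolynomial.eval (fun k => x k) q ^ 2 := by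
        rw [mul_pow]
        field_simp

end Polynomials

/-! ### Measure and incidence of elements and intersections -/

namespace SWIPDP

namespace Mesh

variable {d : ℕ} (T : Mesh d)

theorem isCompact_elem (i : Fin T.size) : IsCompact (T.elem i) := by
  obtain ⟨s, hs⟩ := T.isPolytope i
  rw [hs]
  exact s.finite_toSet.isCompact_convexHull (𝕜 := ℝ)

theorem isCompact_face (e : T.Pair) : IsCompact (T.face e) :=
  (T.isCompact_elem e.1).inter_right (T.isCompact_elem e.2).isClosed

theorem vol_pos (i : Fin T.size) : 0 < T.vol i :=
  ENNReal.toReal_pos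
    (Measure.measure_pos_of_nonempty_interior _ (T.interior_nonempty i)).ne'
    (T.isCompact_elem i).measure_ne_top

theorem norm_normal {e : T.Pair} (he : e.1 ≠ e.2) : ‖T.normal e‖ = 1 := by
  rw [normal, dif_pos he]
  exact (T.exists_isUnitNormal e.1 e.2 he).choose_spec.1

/-- A bounded subset of a hyperplane has finite surface measure. -/
theorem surf_lt_top_of_inner_eq {s : Set (Space d)} (hs : Bornology.IsBounded s) {ν : Space d}
    (hν : ν ≠ 0) (h : ∀ x ∈ s, ∀ y ∈ s, inner ℝ ν x = inner ℝ ν y) : surf d s < ⊤ := by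
  rcases s.eq_empty_or_nonempty with rfl | ⟨p, hp⟩
  · simp
  obtain ⟨D, hD⟩ := hs.subset_closedBall p
  set S : Submodule ℝ (Space d) := (ℝ ∙ ν)ᗮ
  have hfr : Module.finrank ℝ S = d - 1 := by
    have h1 := (ℝ ∙ ν).finrank_add_finrank_orthogonal
    rw [finrank_span_singleton hν, finrank_euclideanSpace_fin] at h1
    change Module.finrank ℝ (ℝ ∙ ν)ᗮ = d - 1
    omega
  -- Up to translation the set lies in a ball of the `(d-1)`-dimensional space `S`, where the
  -- surface measure is Lebesgue measure.
  have hiso : Isometry fun w : S => (w : Space d) + p := Isometry.of_dist_eq fun x y => by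
    rw [dist_add_right]
    rfl
  have hsub : s ⊆ (fun w : S => (w : Space d) + p) '' Metric.closedBall 0 D := fun x hx => by
    have hmem : x - p ∈ S := by
      rw [Submodule.mem_orthogonal_singleton_iff_inner_right, inner_sub_right, h x hx p hp,
        sub_self]
    refine ⟨⟨x - p, hmem⟩, ?_, sub_add_cancel x p⟩
    have := hD hx
    rw [mem_closedBall_iff_norm] at this ⊢
    rw [sub_zero]
    exact this
  refine (measure_mono hsub).trans_lt ?_
  rw [surf, hiso.euclideanHausdorffMeasure_image, ← hfr,
    InnerProductSpace.euclideanHausdorffMeasure_eq_volume]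
  exact measure_closedBall_lt_top

/-- A separating normal satisfies its inequality in both orders on the intersection, so it is
constant there and the intersection lies in a hyperplane. -/
theorem surf_face_lt_top {e : T.Pair} (he : e.1 ≠ e.2) : surf d (T.face e) < ⊤ := by
  obtain ⟨ν, hν, h⟩ := T.exists_isUnitNormal e.1 e.2 he
  refine surf_lt_top_of_inner_eq (T.isCompact_face e).isBounded
    (fun h0 => by simp [h0] at hν) (ν := ν) fun x hx y hy => ?_
  exact le_antisymm (h x hx.1 y hy.2) (h y hy.1 x hx.2)

theorem fst_ne_snd_of_mem_innerFaces {e : T.Pair} (he : e ∈ T.innerFaces) : e.1 ≠ e.2 := by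
  classical
  exact (Finset.mem_filter.mp he).2.1.ne

theorem area_pos {e : T.Pair} (he : e ∈ T.innerFaces) : 0 < T.area e := by
  classical
  exact ENNReal.toReal_pos (Finset.mem_filter.mp he).2.2
    (T.surf_face_lt_top (T.fst_ne_snd_of_mem_innerFaces he)).ne

theorem integrableOn_face {e : T.Pair} (he : e ∈ T.innerFaces) {f : Space d → ℝ}
    (hf : Continuous f) : IntegrableOn f (T.face e) (surf d) := by
  obtain ⟨M, hM⟩ := (T.isCompact_face e).exists_bound_of_continuousOn hf.continuousOn
  exact Measure.integrableOn_of_bounded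
    (T.surf_face_lt_top (T.fst_ne_snd_of_mem_innerFaces he)).ne hf.aestronglyMeasurable
    ((ae_restrict_iff' (T.isCompact_face e).measurableSet).mpr (.of_forall hM))

theorem integrableOn_elem (i : Fin T.size) {f : Space d → ℝ} (hf : Continuous f) :
    IntegrableOn f (T.elem i) :=
  hf.continuousOn.integrableOn_compact (T.isCompact_elem i)

theorem numFaces_pos {e : T.Pair} (he : e ∈ T.innerFaces) {i : Fin T.size}
    (hi : e.1 = i ∨ e.2 = i) : 0 < T.numFaces i := by
  classical
  exact Finset.card_pos.mpr ⟨e, Finset.mem_filter.mpr ⟨he, hi⟩⟩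

/-- Every element is counted once for each of its interior intersections. -/
theorem sum_innerFaces_add (f : Fin T.size → ℝ) :
    ∑ e ∈ T.innerFaces, (f e.1 + f e.2) = ∑ i, T.numFaces i * f i := by
  classical
  have h : ∀ e ∈ T.innerFaces, f e.1 + f e.2 = ∑ i, if e.1 = i ∨ e.2 = i then f i else 0 :=
    fun e he => by
      rw [← Finset.sum_filter, show Finset.univ.filter (fun i => e.1 = i ∨ e.2 = i) = {e.1, e.2} by
        ext i; simp [eq_comm], Finset.sum_pair (T.fst_ne_snd_of_mem_innerFaces he)]
  rw [Finset.sum_congr rfl h, Finset.sum_comm]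
  refine Finset.sum_congr rfl fun i _ => ?_
  rw [← Finset.sum_filter, Finset.sum_const, nsmul_eq_mul, numFaces]

end Mesh

variable {d : ℕ} {T : Mesh d} {p : ℕ}

/-! ### Linearity and continuity of traces and gradients -/

section Linearity

theorem val_add (u v : BrokenPoly T p) (i : Fin T.size) (x : Space d) :
    val (u + v) i x = val u i x + val v i x := by simp [val]

theorem val_smul (c : ℝ) (u : BrokenPoly T p) (i : Fin T.size) (x : Space d) :
    val (c • u) i x = c * val u i x := by simp [val, MvPolynomial.smul_eval]

theorem grad_add (u v : BrokenPoly T p) (i : Fin T.size) (x : Space d) :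
    grad (u + v) i x = grad u i x + grad v i x := by
  ext k; simp [grad]

theorem grad_smul (c : ℝ) (u : BrokenPoly T p) (i : Fin T.size) (x : Space d) :
    grad (c • u) i x = c • grad u i x := by
  ext k; simp [grad, MvPolynomial.smul_eval]

theorem jump_add (u v : BrokenPoly T p) (e : T.Pair) (x : Space d) :
    jump (u + v) e x = jump u e x + jump v e x := by
  simp only [jump, val_add]; ring

theorem jump_smul (c : ℝ) (u : BrokenPoly T p) (e : T.Pair) (x : Space d) :
    jump (c • u) e x = c * jump u e x := by
  simp only [jump, val_smul]; ring

theorem avgNormalDeriv_add (u v : BrokenPoly T p) (e : T.Pair) (x : Space d) :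
    avgNormalDeriv (u + v) e x = avgNormalDeriv u e x + avgNormalDeriv v e x := by
  simp only [avgNormalDeriv, grad_add, inner_add_left]; ring

theorem avgNormalDeriv_smul (c : ℝ) (u : BrokenPoly T p) (e : T.Pair) (x : Space d) :
    avgNormalDeriv (c • u) e x = c * avgNormalDeriv u e x := by
  simp only [avgNormalDeriv, grad_smul, real_inner_smul_left]; ring

end Linearity

section Continuity

variable {V : Type*} [NormedAddCommGroup V] [NormedSpace ℝ V] [FiniteDimensional ℝ V]
  (J : V →ₗ[ℝ] BrokenPoly T p)

theorem continuous_val_linearMap (i : Fin T.size) :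
    Continuous fun z : V × Space d => val (J z.1) i z.2 :=
  continuous_eval_linearMap
    { toFun := fun v => (J v i : MvPolynomial (Fin d) ℝ)
      map_add' := fun v w => by simp
      map_smul' := fun c v => by simp }

@[fun_prop]
theorem continuous_val (u : BrokenPoly T p) (i : Fin T.size) : Continuous (val u i) :=
  continuous_eval_space _

@[fun_prop]
theorem continuous_grad (u : BrokenPoly T p) (i : Fin T.size) : Continuous (grad u i) :=
  (PiLp.continuous_toLp 2 _).comp (continuous_pi fun _ => continuous_eval_space _)

@[fun_prop]
theorem continuous_jump (u : BrokenPoly T p) (e : T.Pair) : Continuous (jump u e) :=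
  (continuous_val u e.1).sub (continuous_val u e.2)

@[fun_prop]
theorem continuous_avgNormalDeriv (u : BrokenPoly T p) (e : T.Pair) :
    Continuous (avgNormalDeriv u e) :=
  (((continuous_grad u e.1).inner continuous_const).add
    ((continuous_grad u e.2).inner continuous_const)).div_const 2

end Continuity

/-! ### Algebra of the forms and the harmonic average -/

section Forms

noncomputable section

/-- The integrand of the form `b` on an intersection, without its weight. -/
def faceIntegrand (η : T.Pair → ℝ) (u v : BrokenPoly T p) (e : T.Pair) (x : Space d) : ℝ :=
  η e / T.width e * jump u e x * jump v e x - avgNormalDeriv u e x * jump v e x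
    - avgNormalDeriv v e x * jump u e x

/-- The contribution of an element to the form `a`. -/
def cellForm (u v : BrokenPoly T p) (i : Fin T.size) : ℝ :=
  ∫ x in T.elem i, inner ℝ (grad u i x) (grad v i x)

/-- The contribution of an intersection to the form `a`. -/
def faceForm (η : T.Pair → ℝ) (u v : BrokenPoly T p) (e : T.Pair) : ℝ :=
  ∫ x in T.face e, faceIntegrand η u v e x ∂(Mesh.surf d)

end

variable (η : T.Pair → ℝ)

@[fun_prop]
theorem continuous_faceIntegrand (u v : BrokenPoly T p) (e : T.Pair) :
    Continuous (faceIntegrand η u v e) := by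
  unfold faceIntegrand
  fun_prop

theorem formB_eq_sum (w : Fin T.size → ℝ) (u v : BrokenPoly T p) :
    formB η w u v = ∑ i, w i * cellForm u v i
      + ∑ e ∈ T.innerFaces, harmonicAvg w e * faceForm η u v e := by
  simp only [formB, integral_const_mul]
  rfl

/-- Lets `a` inherit linearity, continuity and semidefiniteness from `b`. -/
theorem formA_eq_formB (u v : BrokenPoly T p) : formA η u v = formB η (fun _ => 1) u v := by
  have h : ∀ e : T.Pair, harmonicAvg (fun _ => (1 : ℝ)) e = 1 := fun e => by
    norm_num [harmonicAvg]
  simp only [formA, formB, h, one_mul]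

theorem formB_comm (w : Fin T.size → ℝ) (u v : BrokenPoly T p) :
    formB η w u v = formB η w v u := by
  simp only [formB]
  congr 1
  · refine Finset.sum_congr rfl fun i _ => ?_
    simp_rw [real_inner_comm]
  · refine Finset.sum_congr rfl fun e _ => ?_
    refine integral_congr_ae (.of_forall fun x => ?_)
    simp only
    ring

theorem formB_add_right (w : Fin T.size → ℝ) (u v v' : BrokenPoly T p) :
    formB η w u (v + v') = formB η w u v + formB η w u v' := by
  have h1 : ∀ i, cellForm u (v + v') i = cellForm u v i + cellForm u v' i := fun i => by
    simp only [cellForm, grad_add, inner_add_right]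
    exact integral_add (T.integrableOn_elem i (by fun_prop)) (T.integrableOn_elem i (by fun_prop))
  have h2 : ∀ e ∈ T.innerFaces,
      faceForm η u (v + v') e = faceForm η u v e + faceForm η u v' e := fun e he => by
    simp only [faceForm]
    rw [← integral_add (T.integrableOn_face he (by fun_prop))
      (T.integrableOn_face he (by fun_prop))]
    refine integral_congr_ae (.of_forall fun x => ?_)
    simp only [faceIntegrand, jump_add, avgNormalDeriv_add]
    ring
  have h3 : ∑ e ∈ T.innerFaces, harmonicAvg w e * faceForm η u (v + v') e
      = ∑ e ∈ T.innerFaces, harmonicAvg w e * (faceForm η u v e + faceForm η u v' e) :=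
    Finset.sum_congr rfl fun e he => by rw [h2 e he]
  simp only [formB_eq_sum, h1, h3, mul_add, Finset.sum_add_distrib]
  ring

theorem formB_smul_right (w : Fin T.size → ℝ) (c : ℝ) (u v : BrokenPoly T p) :
    formB η w u (c • v) = c * formB η w u v := by
  have h1 : ∀ i, cellForm u (c • v) i = c * cellForm u v i := fun i => by
    simp only [cellForm, grad_smul, inner_smul_right, integral_const_mul]
  have h2 : ∀ e, faceForm η u (c • v) e = c * faceForm η u v e := fun e => by
    simp only [faceForm]
    rw [← integral_const_mul]
    refine integral_congr_ae (.of_forall fun x => ?_)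
    simp only [faceIntegrand, jump_smul, avgNormalDeriv_smul]
    ring
  simp only [formB_eq_sum, h1, h2, mul_add, Finset.mul_sum]
  congr 1 <;> exact Finset.sum_congr rfl fun _ _ => by ring

theorem cellForm_self_nonneg (u : BrokenPoly T p) (i : Fin T.size) : 0 ≤ cellForm u u i :=
  integral_nonneg fun _ => real_inner_self_nonneg

theorem harmonicAvg_nonneg {w : Fin T.size → ℝ} (hw : ∀ i, 0 ≤ w i) (e : T.Pair) :
    0 ≤ harmonicAvg w e := by
  have := hw e.1
  have := hw e.2
  unfold harmonicAvg
  positivity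

theorem harmonicAvg_le_fst {w : Fin T.size → ℝ} (hw : ∀ i, 0 ≤ w i) (e : T.Pair) :
    harmonicAvg w e ≤ 2 * w e.1 := by
  have h1 := hw e.1
  have h2 := hw e.2
  exact div_le_of_le_mul₀ (by positivity) (by positivity)
    (by nlinarith [mul_nonneg h1 h1, mul_nonneg h1 h2])

theorem harmonicAvg_le_snd {w : Fin T.size → ℝ} (hw : ∀ i, 0 ≤ w i) (e : T.Pair) :
    harmonicAvg w e ≤ 2 * w e.2 := by
  have h1 := hw e.1
  have h2 := hw e.2
  exact div_le_of_le_mul₀ (by positivity) (by positivity)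
    (by nlinarith [mul_nonneg h2 h2, mul_nonneg h1 h2])

/-- Where both weights vanish the quotient is `0 / 0 = 0`, and the bound by twice one weight
squeezes it to `0` nearby. This makes degenerate mobilities harmless. -/
theorem continuous_harmonicAvg {X : Type*} [TopologicalSpace X] {w : X → Fin T.size → ℝ}
    (hw : ∀ i, Continuous fun x => w x i) (hw0 : ∀ x i, 0 ≤ w x i) (e : T.Pair) :
    Continuous fun x => harmonicAvg (w x) e := by
  refine continuous_iff_continuousAt.mpr fun x => ?_
  by_cases h : w x e.2 + w x e.1 = 0
  · have h1 : w x e.1 = 0 := by linarith [hw0 x e.1, hw0 x e.2]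
    have h0 : harmonicAvg (w x) e = 0 := by simp [harmonicAvg, h1]
    have h2 : Filter.Tendsto (fun y => 2 * w y e.1) (nhds x) (nhds 0) := by
      have := ((hw e.1).const_mul 2).tendsto x
      rwa [h1, mul_zero] at this
    rw [ContinuousAt, h0]
    exact tendsto_of_tendsto_of_tendsto_of_le_of_le tendsto_const_nhds h2
      (fun y => harmonicAvg_nonneg (hw0 y) e) fun y => harmonicAvg_le_fst (hw0 y) e
  · exact ((((hw e.2).const_mul 2).mul (hw e.1)).continuousAt).div
      ((hw e.2).add (hw e.1)).continuousAt h

end Forms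

/-! ### Positive semidefiniteness of the weighted form -/

section Coercivity

/-- The inverse inequality for the gradients of broken polynomials; there is nothing to control if
they are piecewise constant. -/
theorem exists_norm_grad_sq_mul_vol_le (d p : ℕ) (κ : ℝ) :
    ∃ C : ℝ, 0 ≤ C ∧ (p = 0 → C = 0) ∧ ∀ T : Mesh d, T.ShapeRegular κ →
      ∀ (u : BrokenPoly T p) (i : Fin T.size), ∀ y ∈ T.elem i,
        ‖grad u i y‖ ^ 2 * T.vol i ≤ C * cellForm u u i := by
  rcases Nat.eq_zero_or_pos p with rfl | hp
  · refine ⟨0, le_rfl, fun _ => rfl, fun T _ u i y _ => ?_⟩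
    have hdeg := (MvPolynomial.mem_restrictTotalDegree _ _ _).mp (u i).2
    have hC := MvPolynomial.totalDegree_eq_zero_iff_eq_C.mp (Nat.le_zero.mp hdeg)
    have : grad u i y = 0 := by
      ext k
      simp only [grad]
      rw [hC, MvPolynomial.pderiv_C]
      simp
    simp [this]
  · obtain ⟨C, hC0, hC⟩ := exists_eval_sq_mul_volume_le d p κ
    refine ⟨C, hC0, fun h => absurd h hp.ne', fun T hT u i y hy => ?_⟩
    obtain ⟨x₀, ρ, hρ, hball, hdiam⟩ := hT i
    have hn : ∀ x, inner ℝ (grad u i x) (grad u i x) = ∑ k, MvPolynomial.eval (fun l => x l)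
        (MvPolynomial.pderiv k (u i : MvPolynomial (Fin d) ℝ)) ^ 2 := fun x => by
      rw [real_inner_self_eq_norm_sq, EuclideanSpace.norm_sq_eq]
      simp [grad]
    rw [← real_inner_self_eq_norm_sq, cellForm]
    simp_rw [hn]
    rw [integral_finsetSum (f := fun k (x : Space d) => MvPolynomial.eval (fun l => x l)
        (MvPolynomial.pderiv k (u i : MvPolynomial (Fin d) ℝ)) ^ 2) _
        fun k _ => T.integrableOn_elem i ((continuous_eval_space _).pow 2),
      Finset.sum_mul, Finset.mul_sum]
    refine Finset.sum_le_sum fun k _ => ?_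
    exact hC _ ((MvPolynomial.totalDegree_pderiv_le _ k).trans
      ((MvPolynomial.mem_restrictTotalDegree _ _ _).mp (u i).2)) _ x₀ ρ hρ (T.isCompact_elem i)
      hball hdiam y hy

theorem quadratic_nonneg_of_sq_le {a b g : ℝ} (ha : 0 ≤ a) (hb : 0 ≤ b) (h : g ^ 2 ≤ 4 * a * b)
    (t : ℝ) : 0 ≤ a * t ^ 2 - g * t + b := by
  rcases ha.eq_or_lt with rfl | ha
  · have : g = 0 := by nlinarith
    simp [this, hb]
  · have : 0 ≤ 4 * a * (a * t ^ 2 - g * t + b) := by nlinarith [sq_nonneg (2 * a * t - g)]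
    exact nonneg_of_mul_nonneg_right this (by positivity)

variable {C : ℝ} {u : BrokenPoly T p} {η : T.Pair → ℝ}

/-- Half of the penalty on an intersection absorbs the normal derivative from one side. -/
theorem half_penalty_nonneg {i : Fin T.size} {m A η₀ : ℝ} (hC : 0 ≤ C) (hm : 0 < m) (hA : 0 < A)
    (hη : C * m ≤ η₀) {y ν : Space d}
    (hinv : ‖grad u i y‖ ^ 2 * T.vol i ≤ C * cellForm u u i) (hν : ‖ν‖ = 1) (t : ℝ) :
    0 ≤ η₀ * A / (2 * T.vol i) * t ^ 2 - inner ℝ (grad u i y) ν * t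
      + cellForm u u i / (2 * m * A) := by
  have hV := T.vol_pos i
  have hI := cellForm_self_nonneg u i
  have hη0 : 0 ≤ η₀ := (by positivity : 0 ≤ C * m).trans hη
  refine quadratic_nonneg_of_sq_le (by positivity) (by positivity) ?_ t
  have h1 : (inner ℝ (grad u i y) ν : ℝ) ^ 2 ≤ ‖grad u i y‖ ^ 2 := by
    have := abs_real_inner_le_norm (grad u i y) ν
    rw [hν, mul_one] at this
    rw [← sq_abs]
    exact pow_le_pow_left₀ (abs_nonneg _) this 2
  refine h1.trans ?_
  rw [← le_div_iff₀ hV] at hinv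
  refine hinv.trans ?_
  -- The area cancels in the product, and the size condition on the penalty enters only as `C ≤ η₀ /
  -- m`.
  have : 4 * (η₀ * A / (2 * T.vol i)) * (cellForm u u i / (2 * m * A))
      = η₀ / m * cellForm u u i / T.vol i := by
    field_simp
    ring
  rw [this]
  have h2 : C ≤ η₀ / m := (le_div_iff₀ hm).mpr hη
  gcongr

/-- On the diagonal the integrand is the penalty minus the jump times the sum of both normal
derivatives, so each half of the penalty handles one side. Integrating the constant lower bound
supplies the factor `|e|` that removes the area from it. -/
theorem faceForm_self_ge (hC : 0 ≤ C)
    (hinv : ∀ i, ∀ y ∈ T.elem i, ‖grad u i y‖ ^ 2 * T.vol i ≤ C * cellForm u u i)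
    {e : T.Pair} (he : e ∈ T.innerFaces)
    (hη : C * T.numFaces e.1 ≤ η e ∧ C * T.numFaces e.2 ≤ η e) :
    -(cellForm u u e.1 / (2 * T.numFaces e.1) + cellForm u u e.2 / (2 * T.numFaces e.2))
      ≤ faceForm η u u e := by
  have hA := T.area_pos he
  have hne := T.fst_ne_snd_of_mem_innerFaces he
  have hm1 : (0 : ℝ) < T.numFaces e.1 := by exact_mod_cast T.numFaces_pos he (Or.inl rfl)
  have hm2 : (0 : ℝ) < T.numFaces e.2 := by exact_mod_cast T.numFaces_pos he (Or.inr rfl)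
  have hV1 := T.vol_pos e.1
  have hV2 := T.vol_pos e.2
  set c := cellForm u u e.1 / (2 * T.numFaces e.1 * T.area e)
    + cellForm u u e.2 / (2 * T.numFaces e.2 * T.area e)
  have hpt : ∀ y ∈ T.face e, -c ≤ faceIntegrand η u u e y := fun y hy => by
    have h1 := half_penalty_nonneg hC hm1 hA hη.1 (hinv e.1 y hy.1) (T.norm_normal hne)
      (jump u e y)
    have h2 := half_penalty_nonneg hC hm2 hA hη.2 (hinv e.2 y hy.2) (T.norm_normal hne)
      (jump u e y)
    have h3 : η e / T.width e
        = η e * T.area e / (2 * T.vol e.1) + η e * T.area e / (2 * T.vol e.2) := by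
      rw [Mesh.width]
      field_simp
      ring
    simp only [faceIntegrand, avgNormalDeriv, h3, c]
    nlinarith
  have hfin := T.surf_face_lt_top hne
  have hmono := setIntegral_mono_on (integrableOn_const hfin.ne)
    (T.integrableOn_face he (continuous_faceIntegrand η u u e))
    (T.isCompact_face e).measurableSet hpt
  rw [setIntegral_const, smul_eq_mul] at hmono
  refine le_trans (le_of_eq ?_) hmono
  change _ = T.area e * -c
  simp only [c]
  field_simp

/-- The factor `2` in `⟨w⟩ ≤ 2 w_K` meets the `1/2` of the unweighted bound, so each intersection
costs `K` at most `1 / m_K` of its weighted energy. There are `m_K` of them. -/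
theorem formB_self_nonneg (hC : 0 ≤ C)
    (hinv : ∀ i, ∀ y ∈ T.elem i, ‖grad u i y‖ ^ 2 * T.vol i ≤ C * cellForm u u i)
    (hη : ∀ e ∈ T.innerFaces, C * T.numFaces e.1 ≤ η e ∧ C * T.numFaces e.2 ≤ η e)
    {w : Fin T.size → ℝ} (hw : ∀ i, 0 ≤ w i) : 0 ≤ formB η w u u := by
  set f : Fin T.size → ℝ := fun i => w i * cellForm u u i / T.numFaces i
  have hface : ∀ e ∈ T.innerFaces, -(f e.1 + f e.2) ≤ harmonicAvg w e * faceForm η u u e :=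
    fun e he => by
      have h1 := mul_le_mul_of_nonneg_left (faceForm_self_ge hC hinv he (hη e he))
        (harmonicAvg_nonneg hw e)
      refine le_trans ?_ h1
      have hm : ∀ i, 0 ≤ cellForm u u i / (2 * T.numFaces i) := fun i =>
        div_nonneg (cellForm_self_nonneg u i) (by positivity)
      have h2 := mul_le_mul_of_nonneg_right (harmonicAvg_le_fst hw e) (hm e.1)
      have h3 := mul_le_mul_of_nonneg_right (harmonicAvg_le_snd hw e) (hm e.2)
      have h4 : ∀ i, 2 * w i * (cellForm u u i / (2 * T.numFaces i)) = f i := fun i => by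
        simp only [f]
        rw [mul_div_assoc', mul_assoc, mul_div_mul_left _ _ two_ne_zero]
      rw [h4] at h2 h3
      linarith
  have hsum : ∑ e ∈ T.innerFaces, (f e.1 + f e.2) ≤ ∑ i, w i * cellForm u u i := by
    rw [T.sum_innerFaces_add]
    refine Finset.sum_le_sum fun i _ => ?_
    have := mul_nonneg (hw i) (cellForm_self_nonneg u i)
    rcases Nat.eq_zero_or_pos (T.numFaces i) with h | h
    · simpa [h] using this
    · simp only [f]
      rw [mul_div_cancel₀ _ (by positivity)]
  have := Finset.sum_le_sum hface
  rw [Finset.sum_neg_distrib] at this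
  rw [formB_eq_sum]
  linarith

end Coercivity

/-! ### The `L²` inner product on broken polynomials -/

section InnerProduct

theorem innerProd_comm (f g : Fin T.size → Space d → ℝ) : innerProd f g = innerProd g f := by
  simp only [innerProd, mul_comm]

theorem innerProd_val_add_right {f : Fin T.size → Space d → ℝ} (hf : ∀ i, Continuous (f i))
    (u v : BrokenPoly T p) :
    innerProd f (val (u + v)) = innerProd f (val u) + innerProd f (val v) := by
  simp only [innerProd, ← Finset.sum_add_distrib]
  refine Finset.sum_congr rfl fun i _ => ?_
  have hfi := hf i
  rw [← integral_add (T.integrableOn_elem i (by fun_prop)) (T.integrableOn_elem i (by fun_prop))]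
  simp only [val_add, mul_add]

theorem innerProd_val_smul_right (f : Fin T.size → Space d → ℝ) (c : ℝ) (u : BrokenPoly T p) :
    innerProd f (val (c • u)) = c * innerProd f (val u) := by
  simp only [innerProd, Finset.mul_sum]
  refine Finset.sum_congr rfl fun i _ => ?_
  rw [← integral_const_mul]
  refine integral_congr_ae (.of_forall fun x => ?_)
  simp only [val_smul]
  ring

theorem eq_zero_of_innerProd_self_eq_zero {u : BrokenPoly T p}
    (h : innerProd (val u) (val u) = 0) : u = 0 := by
  have h1 := (Finset.sum_eq_zero_iff_of_nonneg fun i _ =>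
    integral_nonneg (μ := volume.restrict (T.elem i)) fun x => mul_self_nonneg (val u i x)).mp h
  funext i
  exact Subtype.ext (MvPolynomial.eq_zero_of_setIntegral_sq_eq_zero (T.isCompact_elem i)
    (T.interior_nonempty i) (h1 i (Finset.mem_univ i)))

/-- Coordinates on the broken polynomials that are orthonormal in `L²`. -/
theorem exists_orthonormal_coordinates (T : Mesh d) (p : ℕ) :
    ∃ (N : ℕ) (J : EuclideanSpace ℝ (Fin N) ≃ₗ[ℝ] BrokenPoly T p),
      ∀ x y, inner ℝ x y = innerProd (val (J x)) (val (J y)) := by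
  let core : InnerProductSpace.Core ℝ (BrokenPoly T p) :=
    { inner := fun u v => innerProd (val u) (val v)
      conj_inner_symm := fun u v => by
        simp only [conj_trivial]
        exact innerProd_comm _ _
      re_inner_nonneg := fun u => show 0 ≤ innerProd (val u) (val u) from
        Finset.sum_nonneg fun i _ => integral_nonneg fun x => mul_self_nonneg _
      add_left := fun u v w => by
        rw [innerProd_comm, innerProd_val_add_right (continuous_val w), innerProd_comm (val w),
          innerProd_comm (val w)]
      smul_left := fun u v c => by
        simp only [conj_trivial]
        rw [innerProd_comm, innerProd_val_smul_right, innerProd_comm (val v)]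
      definite := fun u hu => eq_zero_of_innerProd_self_eq_zero hu }
  let _ : NormedAddCommGroup (BrokenPoly T p) := core.toNormedAddCommGroup
  let _ : InnerProductSpace ℝ (BrokenPoly T p) := InnerProductSpace.ofCore core.toCore
  set b := stdOrthonormalBasis ℝ (BrokenPoly T p)
  exact ⟨_, b.repr.symm.toLinearEquiv, fun x y => (b.repr.symm.inner_map_map x y).symm⟩

end InnerProduct

/-! ### Continuity of the system in the unknowns -/

section Continuity

variable {V : Type*} [NormedAddCommGroup V] [NormedSpace ℝ V] [FiniteDimensional ℝ V]
  (J : V →ₗ[ℝ] BrokenPoly T p)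

theorem continuous_cellAvg_linearMap (i : Fin T.size) :
    Continuous fun φ : V => cellAvg (J φ) i :=
  continuous_const.mul (continuous_parametric_integral_of_continuous
    (f := fun (φ : V) x => val (J φ) i x) (continuous_val_linearMap J i) (T.isCompact_elem i))

theorem continuous_innerProd_cube_linearMap (φ₀ ξ : BrokenPoly T p) :
    Continuous fun φ : V =>
      innerProd (fun i x => phiPlus (val (J φ) i x) + phiMinus (val φ₀ i x)) (val ξ) := by
  refine continuous_finsetSum _ fun i _ => continuous_parametric_integral_of_continuous
    (f := fun (φ : V) x => (phiPlus (val (J φ) i x) + phiMinus (val φ₀ i x)) * val ξ i x) ?_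
    (T.isCompact_elem i)
  have h := continuous_val_linearMap J i
  have h0 : Continuous fun z : V × Space d => val φ₀ i z.2 :=
    (continuous_val φ₀ i).comp continuous_snd
  have h1 : Continuous fun z : V × Space d => val ξ i z.2 :=
    (continuous_val ξ i).comp continuous_snd
  exact ((h.pow 3).add h0.neg).mul h1

variable (η : T.Pair → ℝ)

/-- Linear maps on a finite-dimensional space are continuous, so no estimate of the integral is
needed. -/
theorem continuous_cellForm_linearMap (ψ : BrokenPoly T p) (i : Fin T.size) :
    Continuous fun υ : V => cellForm (J υ) ψ i := by
  let A : V →ₗ[ℝ] ℝ :=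
    { toFun := fun υ => cellForm (J υ) ψ i
      map_add' := fun υ υ' => by
        simp only [cellForm, map_add, grad_add, inner_add_left]
        exact integral_add (T.integrableOn_elem i (by fun_prop))
          (T.integrableOn_elem i (by fun_prop))
      map_smul' := fun c υ => by
        simp only [cellForm, map_smul, grad_smul, real_inner_smul_left, integral_const_mul]
        rfl }
  exact A.continuous_of_finiteDimensional

theorem continuous_faceForm_linearMap (ψ : BrokenPoly T p) {e : T.Pair}
    (he : e ∈ T.innerFaces) : Continuous fun υ : V => faceForm η (J υ) ψ e := by
  let A : V →ₗ[ℝ] ℝ :=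
    { toFun := fun υ => faceForm η (J υ) ψ e
      map_add' := fun υ υ' => by
        simp only [faceForm]
        rw [← integral_add (T.integrableOn_face he (by fun_prop))
          (T.integrableOn_face he (by fun_prop))]
        refine integral_congr_ae (.of_forall fun x => ?_)
        simp only [faceIntegrand, map_add, jump_add, avgNormalDeriv_add]
        ring
      map_smul' := fun c υ => by
        simp only [faceForm, RingHom.id_apply, smul_eq_mul]
        rw [← integral_const_mul]
        refine integral_congr_ae (.of_forall fun x => ?_)
        simp only [faceIntegrand, map_smul, jump_smul, avgNormalDeriv_smul]
        ring }
  exact A.continuous_of_finiteDimensional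

theorem continuous_formB_linearMap {X : Type*} [TopologicalSpace X] {w : X → Fin T.size → ℝ}
    (hw : ∀ i, Continuous fun x => w x i) (hw0 : ∀ x i, 0 ≤ w x i) {υ : X → V}
    (hυ : Continuous υ) (ψ : BrokenPoly T p) :
    Continuous fun x => formB η (w x) (J (υ x)) ψ := by
  simp only [formB_eq_sum]
  exact (continuous_finsetSum _ fun i _ =>
      (hw i).mul ((continuous_cellForm_linearMap J ψ i).comp hυ)).add
    (continuous_finsetSum _ fun e he =>
      (continuous_harmonicAvg hw hw0 e).mul ((continuous_faceForm_linearMap J η ψ he).comp hυ))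

end Continuity

/-! ### Coercivity of the cubic term and existence -/

theorem mobility_nonneg (s : ℝ) : 0 ≤ mobility s := le_max_right _ _

theorem continuous_mobility : Continuous mobility := by
  unfold mobility
  fun_prop

/-- Convexity of `s⁴/4` bounds the cubic term below by a difference of quartics. Then `s⁴/4 ≥ 4 s² -
16` at `s = t + y`, from `(s² - 8)² ≥ 0`, leaves a positive definite quadratic form in `t` and `y`.
-/
theorem phiPlus_add_phiMinus_mul_ge (t y : ℝ) :
    y ^ 2 - (t ^ 4 / 4 + 17 / 4 * t ^ 2 + 16) ≤ (phiPlus (t + y) + phiMinus t) * y := by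
  unfold phiPlus phiMinus
  have h1 : ((t + y) ^ 4 - t ^ 4) / 4 ≤ (t + y) ^ 3 * y := by
    nlinarith [sq_nonneg y, sq_nonneg (y * (2 * t + y)), sq_nonneg (y * (t + y)),
      sq_nonneg (y * (3 * y + 4 * t)), sq_nonneg (y * t), sq_nonneg (y * y)]
  nlinarith [sq_nonneg ((t + y) ^ 2 - 8), sq_nonneg (y + 2 * t), sq_nonneg (y - t / 2)]

/-- Testing the cubic nonlinearity with an increment controls the increment. -/
theorem exists_innerProd_cube_ge (φ₀ : BrokenPoly T p) :
    ∃ K : ℝ, 0 ≤ K ∧ ∀ u : BrokenPoly T p, innerProd (val u) (val u) - K ≤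
      innerProd (fun i x => phiPlus (val (φ₀ + u) i x) + phiMinus (val φ₀ i x)) (val u) := by
  set k : Fin T.size → Space d → ℝ := fun i x =>
    val φ₀ i x ^ 4 / 4 + 17 / 4 * val φ₀ i x ^ 2 + 16
  have hk : ∀ i, Continuous (k i) := fun i => by fun_prop
  refine ⟨∑ i, ∫ x in T.elem i, k i x, Finset.sum_nonneg fun i _ =>
    integral_nonneg fun x => by simp only [k]; positivity, fun u => ?_⟩
  simp only [innerProd, ← Finset.sum_sub_distrib]
  refine Finset.sum_le_sum fun i _ => ?_
  have hc := continuous_val u i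
  have h0 := continuous_val (φ₀ + u) i
  have h1 := continuous_val φ₀ i
  have hki := hk i
  rw [← integral_sub (T.integrableOn_elem i (by fun_prop)) (T.integrableOn_elem i hki)]
  refine integral_mono (T.integrableOn_elem i ((hc.mul hc).sub (hk i)))
    (T.integrableOn_elem i (((h0.pow 3).add h1.neg).mul hc)) fun x => ?_
  simp only [val_add, k, ← sq]
  exact phiPlus_add_phiMinus_mul_ge _ _

/-- The scheme is solvable as soon as the forms `b(w, ·, ·)` are positive semidefinite. -/
theorem exists_isSolution {η : T.Pair → ℝ}
    (hB : ∀ w : Fin T.size → ℝ, (∀ i, 0 ≤ w i) → ∀ u : BrokenPoly T p, 0 ≤ formB η w u u)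
    {τ Pe Cn : ℝ} (hτ : 0 < τ) (hPe : 0 < Pe) (φ₀ : BrokenPoly T p) :
    ∃ φ₁ υ₁ : BrokenPoly T p, IsSolution η τ Pe Cn φ₀ φ₁ υ₁ := by
  obtain ⟨N, J, hJ⟩ := exists_orthonormal_coordinates T p
  obtain ⟨a₀, rfl⟩ := J.surjective φ₀
  set w : EuclideanSpace ℝ (Fin N) → Fin T.size → ℝ := fun φ i => mobility (cellAvg (J φ) i)
  have hw0 : ∀ φ i, 0 ≤ w φ i := fun φ i => mobility_nonneg _
  have hw : ∀ i, Continuous fun φ => w φ i := fun i =>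
    continuous_mobility.comp (continuous_cellAvg_linearMap J.toLinearMap i)
  have hcube : ∀ (φ : EuclideanSpace ℝ (Fin N)) (i : Fin T.size), Continuous fun x =>
      phiPlus (val (J φ) i x) + phiMinus (val (J a₀) i x) := fun φ i =>
    ((continuous_val (J φ) i).pow 3).add (continuous_val (J a₀) i).neg
  let g : EuclideanSpace ℝ (Fin N) → EuclideanSpace ℝ (Fin N) →ₗ[ℝ] ℝ := fun φ =>
    { toFun := fun ξ => innerProd
          (fun i x => phiPlus (val (J φ) i x) + phiMinus (val (J a₀) i x)) (val (J ξ))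
        + Cn ^ 2 * formA η (J φ) (J ξ)
      map_add' := fun ξ ξ' => by
        simp only [map_add, innerProd_val_add_right (hcube φ), formA_eq_formB, formB_add_right]
        ring
      map_smul' := fun c ξ => by
        simp only [map_smul, innerProd_val_smul_right, formA_eq_formB, formB_smul_right,
          RingHom.id_apply, smul_eq_mul]
        ring }
  let b : EuclideanSpace ℝ (Fin N) → EuclideanSpace ℝ (Fin N) →
      EuclideanSpace ℝ (Fin N) →ₗ[ℝ] ℝ := fun φ υ =>
    { toFun := fun ψ => τ / Pe * formB η (w φ) (J υ) (J ψ)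
      map_add' := fun ψ ψ' => by simp only [map_add, formB_add_right, mul_add]
      map_smul' := fun c ψ => by
        simp only [map_smul, formB_smul_right, RingHom.id_apply, smul_eq_mul]
        ring }
  have hg : ∀ ξ, Continuous fun φ => g φ ξ := fun ξ => by
    refine (continuous_innerProd_cube_linearMap J.toLinearMap (J a₀) (J ξ)).add
      (continuous_const.mul ?_)
    simp only [formA_eq_formB]
    exact continuous_formB_linearMap J.toLinearMap η (fun _ => continuous_const)
      (fun _ _ => zero_le_one) continuous_id (J ξ)
  have hb : ∀ ψ, Continuous fun z : EuclideanSpace ℝ (Fin N) × EuclideanSpace ℝ (Fin N) =>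
      b z.1 z.2 ψ := fun ψ =>
    continuous_const.mul (continuous_formB_linearMap J.toLinearMap η
      (fun i => (hw i).comp continuous_fst) (fun z i => hw0 z.1 i) continuous_snd (J ψ))
  have hpos : ∀ φ υ, 0 ≤ b φ υ υ := fun φ υ =>
    mul_nonneg (by positivity) (hB _ (hw0 φ) (J υ))
  obtain ⟨K, hK0, hK⟩ := exists_innerProd_cube_ge (J a₀)
  -- The part of `g(φ₀ + x)(x)` that is linear in `x`, bounded by its operator norm; `a(x, x)` has a
  -- sign.
  let A : EuclideanSpace ℝ (Fin N) →L[ℝ] ℝ := LinearMap.toContinuousLinearMap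
    { toFun := fun ξ => Cn ^ 2 * formA η (J a₀) (J ξ)
      map_add' := fun ξ ξ' => by simp only [map_add, formA_eq_formB, formB_add_right, mul_add]
      map_smul' := fun c ξ => by
        simp only [map_smul, formA_eq_formB, formB_smul_right, RingHom.id_apply, smul_eq_mul]
        ring }
  -- Nonpositivity gives `‖x‖² ≤ K + ‖A‖ ‖x‖`, which fails once `‖x‖ > ‖A‖ + K + 1`.
  have hR : ∀ x, g (a₀ + x) x ≤ 0 → ‖x‖ ≤ ‖A‖ + K + 1 := fun x hx => by
    have h1 : ‖x‖ ^ 2 - K ≤ innerProd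
        (fun i y => phiPlus (val (J (a₀ + x)) i y) + phiMinus (val (J a₀) i y)) (val (J x)) := by
      rw [← real_inner_self_eq_norm_sq, hJ, map_add]
      exact hK (J x)
    have h2 : A x ≤ Cn ^ 2 * formA η (J (a₀ + x)) (J x) := by
      have h3 := hB (fun _ => 1) (fun _ => zero_le_one) (J x)
      have h4 : formA η (J (a₀ + x)) (J x) = formA η (J a₀) (J x) + formA η (J x) (J x) := by
        simp only [formA_eq_formB, map_add]
        rw [formB_comm, formB_add_right, formB_comm _ _ (J x) (J a₀)]
      rw [h4, mul_add]
      rw [← formA_eq_formB] at h3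
      change Cn ^ 2 * formA η (J a₀) (J x) ≤ _
      have := mul_nonneg (sq_nonneg Cn) h3
      linarith
    have h5 : -(‖A‖ * ‖x‖) ≤ A x := (abs_le.mp (A.le_opNorm x)).1
    have h6 : ‖x‖ ^ 2 - K - ‖A‖ * ‖x‖ ≤ 0 := by
      refine le_trans ?_ hx
      change _ ≤ innerProd _ _ + Cn ^ 2 * formA η _ _
      linarith
    by_contra! hlt
    nlinarith [norm_nonneg A, norm_nonneg x]
  obtain ⟨φ, υ, h1, h2⟩ := exists_solution_of_coercive g b hg hb hpos a₀ hR
  refine ⟨J φ, J υ, fun ψ => ?_, fun ξ => ?_⟩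
  · obtain ⟨ψ, rfl⟩ := J.surjective ψ
    have h := h1 ψ
    rw [hJ, map_sub] at h
    change _ + τ / Pe * formB η (w φ) (J υ) (J ψ) = 0 at h
    have h' : 1 / τ * (innerProd (val (J φ - J a₀)) (val (J ψ))
        + τ / Pe * formB η (w φ) (J υ) (J ψ)) = 0 := by rw [h, mul_zero]
    rw [← h', mul_add]
    congr 1
    field_simp
    rfl
  · obtain ⟨ξ, rfl⟩ := J.surjective ξ
    have h := h2 ξ
    rw [hJ] at h
    change _ = innerProd _ _ + Cn ^ 2 * formA η _ _ at h
    rw [h]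
    ring

end SWIPDP

theorem theorem3 (d : ℕ) (hd : 1 ≤ d) (p : ℕ) (κ : ℝ) :
    ∃ C : ℝ, 0 ≤ C ∧ (p = 0 → C = 0) ∧
      ∀ (T : SWIPDP.Mesh d), T.ShapeRegular κ →
      ∀ η : T.Pair → ℝ,
        (∀ e ∈ T.innerFaces, 0 < η e ∧ C * T.numFaces e.1 ≤ η e ∧ C * T.numFaces e.2 ≤ η e) →
      ∀ τ Pe Cn : ℝ, 0 < τ → 0 < Pe → 0 < Cn →
      ∀ φ₀ : SWIPDP.BrokenPoly T p,
        ∃ φ₁ υ₁ : SWIPDP.BrokenPoly T p, SWIPDP.IsSolution η τ Pe Cn φ₀ φ₁ υ₁ := by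
  obtain ⟨C, hC, hC0, hinv⟩ := SWIPDP.exists_norm_grad_sq_mul_vol_le d p κ
  refine ⟨C, hC, hC0, fun T hT η hη τ Pe Cn hτ hPe _ φ₀ => ?_⟩
  exact SWIPDP.exists_isSolution (fun w hw u => SWIPDP.formB_self_nonneg hC (hinv T hT u)
    (fun e he => (hη e he).2) hw) hτ hPe φ₀
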